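/- For $\omega=(\omega_1,\omega_2)\in(0,\infty)^2$ and $\rho=(\rho_1,\rho_2)\in(0,1]^2$ consider the autonomous system $\dot u=A(\omega,\rho)u$ in $\mathbb R^4$ with $$A(\omega,\rho)=\begin{pmatrix}\Lambda_{11}&0\\0&\Lambda_{22}\end{pmatrix},\qquad \Lambda_{jj}=\begin{pmatrix}j-1&-\omega_j/\rho_j\\ \rho_j\omega_j&j-1\end{pmatrix},\quad j=1,2.$$ For a real $4\times4$ matrix $A$ and a two-dimensional subspace $V\subset\mathbb R^4$ let $$a_{0,T}(V)=\int_0^T\|(I-P_{e^{\tau A}V})\,A\,P_{e^{\tau A}V}\|\,d\tau,$$ where $P_U$ is the orthogonal projection onto $U$ and $\|\cdot\|$ is the spectral norm, and define the second outer angular values $$\vartheta_2^{\sup,\varlimsup}(A)=\sup_{\dim V=2}\varlimsup_{T\to\infty}\tfrac1T a_{0,T}(V),\qquad \vartheta_2^{\sup,\varliminf}(A)=\sup_{\dim V=2}\varliminf_{T\to\infty}\tfrac1T a_{0,T}(V).$$ Put $E_j(\tau)=\dfrac{\rho_j\omega_j}{\cos^2\tau+\rho_j^2\sin^2\tau}$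 for $j=1,2$. Then the following holds. 1. For all $\omega\in(0,\infty)^2$ and $\rho\in(0,1]^2$, the limit $\lim_{T\to\infty}\frac1T a_{0,T}(V)$ exists in $\mathbb R$ for $A=A(\omega,\rho)$ and every two-dimensional $V$. Hence $\vartheta_2^{\sup,\varlimsup}(A(\omega,\rho))=\vartheta_2^{\sup,\varliminf}(A(\omega,\rho))$. This common value is finite and is denoted by $\vartheta_2^{\sup,\lim}(A(\omega,\rho))$. 2. The function $(\omega,\rho)\mapsto\vartheta_2^{\sup,\lim}(A(\omega,\rho))$ is upper semicontinuous on $(0,\infty)^2\times(0,1]^2$. 3. If $\omega_2/\omega_1$ is irrational, then $$\vartheta_2^{\sup,\lim}(A(\omega,\rho))=\frac1{\pi^2}\int_{[0,\pi]^2}\max\big(E_1(\tau_1),E_2(\tau_2)\big)\,d(\tau_1,\tau_2).$$ 4. If $\omega_2/\omega_1=p/q$ with coprime positive integers $p,q$, then $\vartheta_2^{\sup,\lim}(A(\omega,\rho))=\sup_{t\in[0,2\pi]}L(t)$, where $$L(t)=\frac1{2\pi q}\int_0^{2\pi}\sum_{j=1}^q\max\Big(E_1(t+\tau),\,E_2\big(\tfrac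 pq(\tau+2\pi(j-1))\big)\Big)\,d\tau.$$ 5. The function is not lower semicontinuous: already $(\kappa,\rho_2)\mapsto\vartheta_2^{\sup,\lim}(A((1,\kappa),(\tfrac13,\rho_2)))$ is not lower semicontinuous on $(0,1]^2$. -/

import Mathlib

open Set Filter Topology MeasureTheory

noncomputable section

namespace AngularValue

section Euclidean

variable {E : Type*} [NormedAddCommGroup E] [InnerProductSpace ℝ E] [FiniteDimensional ℝ E]

/-- The solution operator `Φ(t, 0) = e^{tA}` of the autonomous system `u' = A u` in the Euclidean
space `E`. -/
def flow (A : E →L[ℝ] E) (t : ℝ) : E →L[ℝ] E :=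
  NormedSpace.exp (t • A)

/-- `t ↦ flow A t u₀` is the solution of `u' = A u` with initial value `u₀`. -/
theorem flow_solves (A : E →L[ℝ] E) (u₀ : E) :
    flow A 0 u₀ = u₀ ∧
      ∀ t : ℝ, HasDerivAt (fun r : ℝ => flow A r u₀) (A (flow A t u₀)) t := by
  have : CompleteSpace E := FiniteDimensional.complete ℝ E
  refine ⟨by simp [flow], fun t => ?_⟩
  have h := hasDerivAt_exp_smul_const' (𝕂 := ℝ) A t
  exact ((ContinuousLinearMap.apply ℝ E u₀).hasFDerivAt).comp_hasDerivAt t h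

/-- The image `Φ(τ, 0) V` of the subspace `V` under the flow. -/
def image (A : E →L[ℝ] E) (τ : ℝ) (V : Submodule ℝ E) : Submodule ℝ E :=
  V.map (flow A τ).toLinearMap

/-- The angular speed `‖(I - P) A P‖`, with the operator norm, where `P` is the orthogonal
projection onto `Φ(τ, 0) V`. -/
def angularSpeed (A : E →L[ℝ] E) (V : Submodule ℝ E) (τ : ℝ) : ℝ :=
  ‖(ContinuousLinearMap.id ℝ E - (image A τ V).starProjection) ∘L A ∘L
    (image A τ V).starProjection‖

/-- The average `(1/T) a_{0,T}(V)` of the angular speed over `[0, T]`. -/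
def averageSpeed (A : E →L[ℝ] E) (V : Submodule ℝ E) (T : ℝ) : ℝ :=
  1 / T * ∫ τ in (0 : ℝ)..T, angularSpeed A V τ

variable (E) in
/-- The Grassmannian of `s`-dimensional subspaces of `E`. -/
def grassmannian (s : ℕ) : Set (Submodule ℝ E) :=
  {V | Module.finrank ℝ V = s}

/-- The outer angular value `ϑ_s^{sup,limsup}(A)`, taken in `[-∞, ∞]`. -/
def outerSupLimsup (s : ℕ) (A : E →L[ℝ] E) : EReal :=
  ⨆ V ∈ grassmannian E s, limsup (fun T : ℝ => (averageSpeed A V T : EReal)) atTop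

/-- The outer angular value `ϑ_s^{sup,liminf}(A)`, taken in `[-∞, ∞]`. -/
def outerSupLiminf (s : ℕ) (A : E →L[ℝ] E) : EReal :=
  ⨆ V ∈ grassmannian E s, liminf (fun T : ℝ => (averageSpeed A V T : EReal)) atTop

end Euclidean

/-- The block diagonal matrix `A(ω, ρ)` of the four-dimensional model system. -/
def modelMatrix (ω ρ : ℝ × ℝ) : Matrix (Fin 4) (Fin 4) ℝ :=
  !![0, -(ω.1 / ρ.1), 0, 0;
     ρ.1 * ω.1, 0, 0, 0;
     0, 0, 1, -(ω.2 / ρ.2);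
     0, 0, ρ.2 * ω.2, 1]

/-- The matrix `A(ω, ρ)` as an operator of `ℝ⁴` with the Euclidean norm. -/
def modelOp (ω ρ : ℝ × ℝ) : EuclideanSpace ℝ (Fin 4) →L[ℝ] EuclideanSpace ℝ (Fin 4) :=
  Matrix.toEuclideanCLM (n := Fin 4) (𝕜 := ℝ) (modelMatrix ω ρ)

/-- The parameters `(ω, ρ)` with `ω ∈ (0, ∞)²` and `ρ ∈ (0, 1]²`. -/
def parameters : Set ((ℝ × ℝ) × (ℝ × ℝ)) :=
  (Ioi 0 ×ˢ Ioi 0) ×ˢ (Ioc 0 1 ×ˢ Ioc 0 1)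

/-- `E(τ) = ρ ω / (cos² τ + ρ² sin² τ)`. -/
def ellipseSpeed (ρ ω τ : ℝ) : ℝ :=
  ρ * ω / (Real.cos τ ^ 2 + ρ ^ 2 * Real.sin τ ^ 2)

/-- The value in the nonresonant case. -/
def nonresonantValue (ω ρ : ℝ × ℝ) : ℝ :=
  1 / Real.pi ^ 2 * ∫ τ in Icc 0 Real.pi ×ˢ Icc 0 Real.pi,
    max (ellipseSpeed ρ.1 ω.1 τ.1) (ellipseSpeed ρ.2 ω.2 τ.2)

/-- The function `L` of the resonant case `ω₂ / ω₁ = p / q`. -/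
def resonantL (ω ρ : ℝ × ℝ) (p q : ℕ) (t : ℝ) : ℝ :=
  1 / (2 * Real.pi * q) * ∫ τ in (0 : ℝ)..(2 * Real.pi), ∑ j ∈ Finset.Icc 1 q,
    max (ellipseSpeed ρ.1 ω.1 (t + τ))
      (ellipseSpeed ρ.2 ω.2 ((p : ℝ) / q * (τ + 2 * Real.pi * ((j : ℝ) - 1))))

end AngularValue

end

/-! The second block grows like `e^t` while the first stays bounded. Hence a plane `V` is attracted
exponentially to `W = (V ∩ ker p) ⊕ pV`, with `p = fastProj` the projection onto the second block
(`exists_map_eq`, `norm_flow_conj_le`), and `V` and `W` have the same average angular speed. Either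
`W` is one of the two blocks, which is invariant and has speed zero, or `W` is spanned by one line
in each block. In the second case parametrize the lines by ellipses with half axes `1, ρ_j`: the
flow moves the two angles at constant velocities `ω_1, ω_2`, and the angular speed is the larger of
`E_1, E_2` at these angles (`norm_angular_rate_ellipsePlane`).

The problem thus becomes one about averages of a continuous function along a linear flow on the
torus of angles modulo `π`. For irrational `ω_2/ω_1` they converge to the torus mean by Weyl's
theorem; for rational ratio the orbits are periodic and the limit is the average over a period. Both
limits are uniform in the initial angles (`uniform_average`), and the angular value is the supremum
`supMeanSpeed` of the limits.

Upper semicontinuity: cutting time into pieces of length `T` shows that the supremum of the averages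
over `[0, T]` bounds `supMeanSpeed` for every `T`, and this bound varies continuously with the
parameters. Lower semicontinuity fails at `ω = (1, 1)`, `ρ = (1/3, 1/3)`: there the torus mean is
the mean of the nonconstant function `L`, hence strictly below `sup L`, while irrational `κ < 1`
arbitrarily close to `1` give at most the torus mean. -/

namespace AngularValue

/-! ### Equidistribution of nonresonant linear flows on the torus -/

/-- The point of the two-dimensional torus with angles `a, b` modulo `π`. -/
noncomputable def torusPoint (a b : ℝ) : UnitAddTorus (Fin 2) :=
  ![((a / Real.pi : ℝ) : UnitAddCircle), ((b / Real.pi : ℝ) : UnitAddCircle)]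

theorem continuous_torusPoint : Continuous fun p : ℝ × ℝ => torusPoint p.1 p.2 := by
  refine continuous_pi fun i => ?_
  fin_cases i
  · exact (AddCircle.continuous_mk' 1).comp (continuous_fst.div_const _)
  · exact (AddCircle.continuous_mk' 1).comp (continuous_snd.div_const _)

theorem fourier_div_pi (n : ℤ) (a : ℝ) :
    fourier n ((a / Real.pi : ℝ) : UnitAddCircle) = Complex.exp (2 * Complex.I * n * a) := by
  rw [fourier_coe_apply]
  congr 1
  have : (Real.pi : ℂ) ≠ 0 := by exact_mod_cast Real.pi_ne_zero
  push_cast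
  field_simp

theorem mFourier_torusPoint (n : Fin 2 → ℤ) (a b : ℝ) :
    UnitAddTorus.mFourier n (torusPoint a b) =
      Complex.exp (2 * Complex.I * n 0 * a) * Complex.exp (2 * Complex.I * n 1 * b) := by
  simp only [UnitAddTorus.mFourier, ContinuousMap.coe_mk, Fin.prod_univ_two]
  rw [← fourier_div_pi, ← fourier_div_pi]
  rfl

/-- The mean over the torus. -/
noncomputable def torusMean (F : C(UnitAddTorus (Fin 2), ℂ)) : ℂ :=
  1 / (Real.pi : ℂ) ^ 2 * ∫ τ in Icc 0 Real.pi ×ˢ Icc 0 Real.pi, F (torusPoint τ.1 τ.2)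

theorem integrableOn_square {f : ℝ × ℝ → ℂ} (hf : Continuous f) (a b : ℝ) :
    IntegrableOn f (Icc a b ×ˢ Icc a b) :=
  hf.continuousOn.integrableOn_compact (isCompact_Icc.prod isCompact_Icc)

theorem continuous_comp_torusPoint (F : C(UnitAddTorus (Fin 2), ℂ)) :
    Continuous fun τ : ℝ × ℝ => F (torusPoint τ.1 τ.2) :=
  F.continuous.comp continuous_torusPoint

theorem torusMean_add (F G : C(UnitAddTorus (Fin 2), ℂ)) :
    torusMean (F + G) = torusMean F + torusMean G := by
  simp only [torusMean, ContinuousMap.add_apply]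
  rw [integral_add (integrableOn_square (continuous_comp_torusPoint F) _ _)
    (integrableOn_square (continuous_comp_torusPoint G) _ _), mul_add]

theorem torusMean_smul (c : ℂ) (F : C(UnitAddTorus (Fin 2), ℂ)) :
    torusMean (c • F) = c * torusMean F := by
  simp only [torusMean, ContinuousMap.smul_apply, smul_eq_mul]
  rw [integral_const_mul]
  ring

theorem volume_square_real :
    (volume : Measure (ℝ × ℝ)).real (Icc 0 Real.pi ×ˢ Icc 0 Real.pi) = Real.pi ^ 2 := by
  rw [Measure.volume_eq_prod, measureReal_prod_prod]
  simp [Real.pi_pos.le, sq]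

theorem norm_torusMean_le (F : C(UnitAddTorus (Fin 2), ℂ)) : ‖torusMean F‖ ≤ ‖F‖ := by
  have h := norm_setIntegral_le_of_norm_le_const (μ := (volume : Measure (ℝ × ℝ)))
    (s := Icc 0 Real.pi ×ˢ Icc 0 Real.pi) (f := fun τ => F (torusPoint τ.1 τ.2)) (C := ‖F‖)
    (isCompact_Icc.prod isCompact_Icc).measure_lt_top (fun x _ => F.norm_coe_le_norm _)
  rw [volume_square_real] at h
  have hp := Real.pi_pos
  rw [torusMean, norm_mul, norm_div, norm_pow, Complex.norm_real, Real.norm_eq_abs,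
    abs_of_pos hp, norm_one, one_div, inv_mul_le_iff₀ (by positivity)]
  linarith

theorem integral_exp_two_pi (n : ℤ) :
    ∫ τ in Icc 0 Real.pi, Complex.exp (2 * Complex.I * n * τ) = if n = 0 then (Real.pi : ℂ) else 0 := by
  rw [integral_Icc_eq_integral_Ioc, ← intervalIntegral.integral_of_le Real.pi_pos.le]
  split_ifs with h
  · simp [h]
  · have hn : (2 * Complex.I * n : ℂ) ≠ 0 := by simp [h]
    rw [integral_exp_mul_complex hn]
    have : Complex.exp (2 * Complex.I * n * Real.pi) = 1 := by
      rw [Complex.exp_eq_one_iff]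
      exact ⟨n, by ring⟩
    simp [this]

theorem torusMean_mFourier (n : Fin 2 → ℤ) :
    torusMean (UnitAddTorus.mFourier n) = if n = 0 then 1 else 0 := by
  simp only [torusMean, mFourier_torusPoint]
  rw [Measure.volume_eq_prod,
    setIntegral_prod_mul (fun x : ℝ => Complex.exp (2 * Complex.I * n 0 * x))
    (fun y : ℝ => Complex.exp (2 * Complex.I * n 1 * y)), integral_exp_two_pi, integral_exp_two_pi]
  have hp : (Real.pi : ℂ) ≠ 0 := by exact_mod_cast Real.pi_ne_zero
  have hn : n = 0 ↔ n 0 = 0 ∧ n 1 = 0 := by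
    rw [funext_iff, Fin.forall_fin_two]; rfl
  by_cases h0 : n 0 = 0 <;> by_cases h1 : n 1 = 0 <;> simp [hn, h0, h1]
  field_simp

/-- The linear flow with velocity `ω` averages `F` to its mean, uniformly in the initial angles. -/
def Equidistributes (ω : ℝ × ℝ) (F : C(UnitAddTorus (Fin 2), ℂ)) : Prop :=
  ∀ ε > 0, ∃ T₀ > 0, ∀ T ≥ T₀, ∀ a b : ℝ,
    ‖(∫ t in (0 : ℝ)..T, F (torusPoint (a + ω.1 * t) (b + ω.2 * t))) - T * torusMean F‖ ≤ ε * T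

theorem continuous_orbit (F : C(UnitAddTorus (Fin 2), ℂ)) (ω : ℝ × ℝ) (a b : ℝ) :
    Continuous fun t : ℝ => F (torusPoint (a + ω.1 * t) (b + ω.2 * t)) :=
  (continuous_comp_torusPoint F).comp (by fun_prop :
    Continuous fun t : ℝ => (a + ω.1 * t, b + ω.2 * t))

theorem Equidistributes.add {ω : ℝ × ℝ} {F G : C(UnitAddTorus (Fin 2), ℂ)}
    (hF : Equidistributes ω F) (hG : Equidistributes ω G) : Equidistributes ω (F + G) := by
  intro ε hε
  obtain ⟨T₁, h1, hT₁⟩ := hF (ε / 2) (by positivity)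
  obtain ⟨T₂, h2, hT₂⟩ := hG (ε / 2) (by positivity)
  refine ⟨max T₁ T₂, lt_max_of_lt_left h1, fun T hT a b => ?_⟩
  have e1 := hT₁ T (le_trans (le_max_left _ _) hT) a b
  have e2 := hT₂ T (le_trans (le_max_right _ _) hT) a b
  simp only [ContinuousMap.add_apply]
  rw [intervalIntegral.integral_add ((continuous_orbit F ω a b).intervalIntegrable _ _)
    ((continuous_orbit G ω a b).intervalIntegrable _ _), torusMean_add]
  calc _ = ‖((∫ t in (0 : ℝ)..T, F (torusPoint (a + ω.1 * t) (b + ω.2 * t))) - T * torusMean F) +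
      ((∫ t in (0 : ℝ)..T, G (torusPoint (a + ω.1 * t) (b + ω.2 * t))) - T * torusMean G)‖ := by
        congr 1; ring
    _ ≤ _ := (norm_add_le _ _).trans (by linarith)

theorem Equidistributes.smul {ω : ℝ × ℝ} {F : C(UnitAddTorus (Fin 2), ℂ)}
    (hF : Equidistributes ω F) (c : ℂ) : Equidistributes ω (c • F) := by
  intro ε hε
  obtain ⟨T₀, h0, h⟩ := hF (ε / (‖c‖ + 1)) (by positivity)
  refine ⟨T₀, h0, fun T hT a b => ?_⟩
  have e := h T hT a b
  simp only [ContinuousMap.smul_apply, smul_eq_mul]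
  rw [intervalIntegral.integral_const_mul, torusMean_smul]
  calc _ = ‖c‖ * ‖(∫ t in (0 : ℝ)..T, F (torusPoint (a + ω.1 * t) (b + ω.2 * t))) -
      T * torusMean F‖ := by rw [← norm_mul]; congr 1; ring
    _ ≤ (‖c‖ + 1) * (ε / (‖c‖ + 1) * T) := by gcongr; linarith
    _ = ε * T := by field_simp

/-- A nonconstant character restricted to an orbit is a unimodular constant times `exp (l t)`, where
independence of the frequencies gives `l ≠ 0`. Its integral is then bounded by `2 / ‖l‖` for all
times and all initial angles. -/
theorem equidistributes_mFourier {ω : ℝ × ℝ} (hω : ∀ m n : ℤ, m * ω.1 + n * ω.2 = 0 → m = 0 ∧ n = 0)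
    (n : Fin 2 → ℤ) : Equidistributes ω (UnitAddTorus.mFourier n) := by
  intro ε hε
  by_cases hn : n = 0
  · subst hn
    refine ⟨1, one_pos, fun T hT a b => ?_⟩
    rw [torusMean_mFourier]
    simp [mFourier_torusPoint]
    positivity
  · set l : ℂ := 2 * Complex.I * ((n 0 * ω.1 + n 1 * ω.2 : ℝ) : ℂ) with hl
    have hl0 : l ≠ 0 := by
      intro h
      apply hn
      have h' : (n 0 * ω.1 + n 1 * ω.2 : ℝ) = 0 := by
        simpa [hl, Complex.ofReal_eq_zero, -Complex.ofReal_add, -Complex.ofReal_mul] using h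
      obtain ⟨h0, h1⟩ := hω _ _ h'
      ext i; fin_cases i
      · exact h0
      · exact h1
    have hlpos : 0 < ‖l‖ := norm_pos_iff.2 hl0
    refine ⟨2 / ‖l‖ / ε, by positivity, fun T hT a b => ?_⟩
    rw [torusMean_mFourier, if_neg hn, mul_zero, sub_zero]
    have e : ∀ t : ℝ, UnitAddTorus.mFourier n (torusPoint (a + ω.1 * t) (b + ω.2 * t)) =
        Complex.exp ((2 * (n 0 * a + n 1 * b) : ℝ) * Complex.I) * Complex.exp (l * t) := by
      intro t
      rw [mFourier_torusPoint, ← Complex.exp_add, ← Complex.exp_add]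
      congr 1
      rw [hl]; push_cast; ring
    simp_rw [e]
    rw [intervalIntegral.integral_const_mul, integral_exp_mul_complex hl0, norm_mul,
      Complex.norm_exp_ofReal_mul_I, one_mul, norm_div]
    have e1 : ∀ t : ℝ, ‖Complex.exp (l * t)‖ = 1 := by
      intro t
      have : l * t = ((2 * (n 0 * ω.1 + n 1 * ω.2) * t : ℝ) : ℂ) * Complex.I := by
        rw [hl]; push_cast; ring
      rw [this, Complex.norm_exp_ofReal_mul_I]
    have e2 := norm_sub_le (Complex.exp (l * T)) (Complex.exp (l * (0 : ℝ)))
    rw [e1, e1] at e2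
    calc _ ≤ 2 / ‖l‖ := by gcongr; linarith
      _ = ε * (2 / ‖l‖ / ε) := by field_simp
      _ ≤ ε * T := by gcongr

/-- Trigonometric polynomials are dense in the sup norm, and both the orbit average and the torus
mean are contractions for that norm, so three errors of `ε / 3` suffice. -/
theorem equidistributes_of_independent {ω : ℝ × ℝ}
    (hω : ∀ m n : ℤ, m * ω.1 + n * ω.2 = 0 → m = 0 ∧ n = 0) (F : C(UnitAddTorus (Fin 2), ℂ)) :
    Equidistributes ω F := by
  have hspan : ∀ G ∈ Submodule.span ℂ (range (UnitAddTorus.mFourier (d := Fin 2))),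
      Equidistributes ω G := by
    intro G hG
    induction hG using Submodule.span_induction with
    | mem x hx => obtain ⟨n, rfl⟩ := hx; exact equidistributes_mFourier hω n
    | zero =>
      have := (equidistributes_mFourier hω 0).smul 0
      convert this using 1
      ext x
      simp
    | add x y _ _ hx hy => exact hx.add hy
    | smul c x _ hx => exact hx.smul c
  intro ε hε
  have hF : F ∈ (Submodule.span ℂ (range (UnitAddTorus.mFourier (d := Fin 2)))).topologicalClosure := by
    rw [UnitAddTorus.span_mFourier_closure_eq_top]; trivial
  obtain ⟨G, hG, hFG⟩ := Metric.mem_closure_iff.1 hF (ε / 3) (by positivity)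
  rw [dist_eq_norm] at hFG
  obtain ⟨T₀, h0, h⟩ := hspan G hG (ε / 3) (by positivity)
  refine ⟨T₀, h0, fun T hT a b => ?_⟩
  have hTpos : 0 < T := lt_of_lt_of_le h0 hT
  have e1 := h T hT a b
  have e2 : ‖∫ t in (0 : ℝ)..T, (F - G) (torusPoint (a + ω.1 * t) (b + ω.2 * t))‖ ≤ ε / 3 * T := by
    refine (intervalIntegral.norm_integral_le_of_norm_le_const (C := ε / 3) fun t _ =>
      ((F - G).norm_coe_le_norm _).trans hFG.le).trans ?_
    rw [sub_zero, abs_of_pos hTpos]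
  have e3 : ‖(T : ℂ) * torusMean (F - G)‖ ≤ ε / 3 * T := by
    rw [norm_mul, Complex.norm_real, Real.norm_eq_abs, abs_of_pos hTpos, mul_comm]
    gcongr
    exact (norm_torusMean_le _).trans hFG.le
  have e4 : F = (F - G) + G := by simp
  have e5 : ∫ t in (0 : ℝ)..T, F (torusPoint (a + ω.1 * t) (b + ω.2 * t)) =
      (∫ t in (0 : ℝ)..T, (F - G) (torusPoint (a + ω.1 * t) (b + ω.2 * t))) +
      ∫ t in (0 : ℝ)..T, G (torusPoint (a + ω.1 * t) (b + ω.2 * t)) := by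
    rw [← intervalIntegral.integral_add ((continuous_orbit _ ω a b).intervalIntegrable _ _)
      ((continuous_orbit G ω a b).intervalIntegrable _ _)]
    simp
  have e6 : torusMean F = torusMean (F - G) + torusMean G := by rw [← torusMean_add, ← e4]
  rw [e5, e6]
  set A := ∫ t in (0 : ℝ)..T, (F - G) (torusPoint (a + ω.1 * t) (b + ω.2 * t))
  set B := ∫ t in (0 : ℝ)..T, G (torusPoint (a + ω.1 * t) (b + ω.2 * t))
  calc _ = ‖A + (B - T * torusMean G) + -(T * torusMean (F - G))‖ := by congr 1; ring
    _ ≤ ‖A‖ + ‖B - T * torusMean G‖ + ‖(T : ℂ) * torusMean (F - G)‖ := by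
      rw [← norm_neg ((T : ℂ) * torusMean (F - G))]; exact norm_add₃_le
    _ ≤ ε * T := by linarith

theorem independent_of_irrational {ω : ℝ × ℝ} (h1 : 0 < ω.1) (hω : Irrational (ω.2 / ω.1))
    (m n : ℤ) (h : m * ω.1 + n * ω.2 = 0) : m = 0 ∧ n = 0 := by
  have hn : n = 0 := by
    by_contra hn
    apply hω
    have hn' : (n : ℝ) ≠ 0 := by exact_mod_cast hn
    refine ⟨-(m / n : ℚ), ?_⟩
    push_cast
    field_simp
    linarith
  subst hn
  simp [h1.ne'] at h
  exact ⟨h, rfl⟩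

/-- Uniform averaging of `max (e₁, e₂)` along a nonresonant linear flow. -/
theorem average_max_of_irrational {ω : ℝ × ℝ} (h1 : 0 < ω.1) (hω : Irrational (ω.2 / ω.1))
    {e₁ e₂ : ℝ → ℝ} (c₁ : Continuous e₁) (c₂ : Continuous e₂)
    (p₁ : Function.Periodic e₁ Real.pi) (p₂ : Function.Periodic e₂ Real.pi) {ε : ℝ} (hε : 0 < ε) :
    ∃ T₀ > 0, ∀ T ≥ T₀, ∀ a b : ℝ,
      |1 / T * (∫ t in (0 : ℝ)..T, max (e₁ (a + ω.1 * t)) (e₂ (b + ω.2 * t))) -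
        1 / Real.pi ^ 2 * ∫ τ in Icc 0 Real.pi ×ˢ Icc 0 Real.pi, max (e₁ τ.1) (e₂ τ.2)| ≤ ε := by
  have hp := Real.pi_pos
  -- A `π`-periodic function descends to the circle of length one after rescaling by `π`, which
  -- matches the normalization in `torusPoint`.
  have lift : ∀ e : ℝ → ℝ, Continuous e → Function.Periodic e Real.pi →
      ∃ f : UnitAddCircle → ℝ, Continuous f ∧ ∀ a : ℝ, f ((a / Real.pi : ℝ) : UnitAddCircle) = e a := by
    intro e ce pe
    have per : Function.Periodic (fun x => e (x * Real.pi)) 1 := by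
      intro x
      simp only [add_mul, one_mul]
      exact pe _
    refine ⟨per.lift, ?_, fun a => ?_⟩
    · exact continuous_coinduced_dom.2 (ce.comp (continuous_mul_const _))
    · rw [Function.Periodic.lift_coe, div_mul_cancel₀ _ hp.ne']
  obtain ⟨f₁, cf₁, hf₁⟩ := lift e₁ c₁ p₁
  obtain ⟨f₂, cf₂, hf₂⟩ := lift e₂ c₂ p₂
  let F : C(UnitAddTorus (Fin 2), ℂ) :=
    ⟨fun x => ((max (f₁ (x 0)) (f₂ (x 1)) : ℝ) : ℂ), by fun_prop⟩
  have hF : ∀ a b, F (torusPoint a b) = ((max (e₁ a) (e₂ b) : ℝ) : ℂ) := by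
    intro a b
    change ((max (f₁ ((a / Real.pi : ℝ) : UnitAddCircle)) (f₂ ((b / Real.pi : ℝ) : UnitAddCircle)) : ℝ) : ℂ) = _
    rw [hf₁, hf₂]
  obtain ⟨T₀, h0, h⟩ := equidistributes_of_independent (independent_of_irrational h1 hω) F ε hε
  refine ⟨T₀, h0, fun T hT a b => ?_⟩
  have hTpos : 0 < T := lt_of_lt_of_le h0 hT
  have e := h T hT a b
  have em : torusMean F = ((1 / Real.pi ^ 2 *
      ∫ τ in Icc 0 Real.pi ×ˢ Icc 0 Real.pi, max (e₁ τ.1) (e₂ τ.2) : ℝ) : ℂ) := by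
    simp only [torusMean, hF]
    rw [integral_complex_ofReal]
    push_cast
    rfl
  rw [em] at e
  simp only [hF] at e
  rw [intervalIntegral.integral_ofReal, ← Complex.ofReal_mul, ← Complex.ofReal_sub,
    Complex.norm_real, Real.norm_eq_abs] at e
  set A := ∫ t in (0 : ℝ)..T, max (e₁ (a + ω.1 * t)) (e₂ (b + ω.2 * t))
  set B := 1 / Real.pi ^ 2 * ∫ τ in Icc 0 Real.pi ×ˢ Icc 0 Real.pi, max (e₁ τ.1) (e₂ τ.2)
  have : 1 / T * A - B = (A - T * B) / T := by field_simp
  rw [this, abs_div, abs_of_pos hTpos, div_le_iff₀ hTpos]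
  exact e

/-! ### Ellipse speeds and their long-time averages along orbits -/

theorem ellipse_denom_ge {ρ : ℝ} (hρ : ρ ∈ Ioc (0 : ℝ) 1) (τ : ℝ) :
    ρ ^ 2 ≤ Real.cos τ ^ 2 + ρ ^ 2 * Real.sin τ ^ 2 := by
  have h := Real.sin_sq_add_cos_sq τ
  have h1 : ρ ^ 2 ≤ 1 := pow_le_one₀ hρ.1.le hρ.2
  nlinarith [sq_nonneg (Real.cos τ)]

theorem ellipse_denom_pos {ρ : ℝ} (hρ : ρ ∈ Ioc (0 : ℝ) 1) (τ : ℝ) :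
    0 < Real.cos τ ^ 2 + ρ ^ 2 * Real.sin τ ^ 2 :=
  lt_of_lt_of_le (pow_pos hρ.1 2) (ellipse_denom_ge hρ τ)

theorem ellipseSpeed_nonneg {ρ ω : ℝ} (hρ : ρ ∈ Ioc (0 : ℝ) 1) (hω : 0 < ω) (τ : ℝ) :
    0 ≤ ellipseSpeed ρ ω τ :=
  div_nonneg (mul_pos hρ.1 hω).le (ellipse_denom_pos hρ τ).le

theorem ellipseSpeed_le {ρ ω : ℝ} (hρ : ρ ∈ Ioc (0 : ℝ) 1) (hω : 0 < ω) (τ : ℝ) :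
    ellipseSpeed ρ ω τ ≤ ρ * ω / ρ ^ 2 :=
  div_le_div_of_nonneg_left (mul_pos hρ.1 hω).le (pow_pos hρ.1 2) (ellipse_denom_ge hρ τ)

theorem ellipseSpeed_periodic (ρ ω : ℝ) : Function.Periodic (ellipseSpeed ρ ω) Real.pi := by
  intro τ
  simp [ellipseSpeed, Real.cos_add_pi, Real.sin_add_pi]

theorem continuous_ellipseSpeed {ρ : ℝ} (hρ : ρ ∈ Ioc (0 : ℝ) 1) (ω : ℝ) :
    Continuous (ellipseSpeed ρ ω) :=
  continuous_const.div (by fun_prop) fun τ => (ellipse_denom_pos hρ τ).ne'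

theorem ellipseSpeed_mono {ρ : ℝ} (hρ : ρ ∈ Ioc (0 : ℝ) 1) {ω ω' : ℝ} (h : ω ≤ ω') (τ : ℝ) :
    ellipseSpeed ρ ω τ ≤ ellipseSpeed ρ ω' τ :=
  div_le_div_of_nonneg_right (mul_le_mul_of_nonneg_left h hρ.1.le) (ellipse_denom_pos hρ τ).le

/-- The larger of the two angular speeds at the angles `a, b`. -/
noncomputable def maxSpeed (ω ρ : ℝ × ℝ) (a b : ℝ) : ℝ :=
  max (ellipseSpeed ρ.1 ω.1 a) (ellipseSpeed ρ.2 ω.2 b)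

section

variable {ω ρ : ℝ × ℝ}

theorem maxSpeed_nonneg (h : (ω, ρ) ∈ parameters) (a b : ℝ) : 0 ≤ maxSpeed ω ρ a b :=
  le_max_of_le_left (ellipseSpeed_nonneg h.2.1 h.1.1 a)

theorem exists_maxSpeed_le (h : (ω, ρ) ∈ parameters) : ∃ C > 0, ∀ a b, maxSpeed ω ρ a b ≤ C := by
  refine ⟨max (ρ.1 * ω.1 / ρ.1 ^ 2) (ρ.2 * ω.2 / ρ.2 ^ 2), ?_, fun a b => ?_⟩
  · exact lt_max_of_lt_left (div_pos (mul_pos h.2.1.1 h.1.1) (pow_pos h.2.1.1 2))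
  · exact max_le_max (ellipseSpeed_le h.2.1 h.1.1 a) (ellipseSpeed_le h.2.2 h.1.2 b)

theorem continuous_maxSpeed (h : (ω, ρ) ∈ parameters) :
    Continuous fun x : ℝ × ℝ => maxSpeed ω ρ x.1 x.2 :=
  ((continuous_ellipseSpeed h.2.1 _).comp continuous_fst).max
    ((continuous_ellipseSpeed h.2.2 _).comp continuous_snd)

theorem continuous_maxSpeed_comp (h : (ω, ρ) ∈ parameters) {X : Type*} [TopologicalSpace X]
    {f g : X → ℝ} (hf : Continuous f) (hg : Continuous g) :
    Continuous fun x => maxSpeed ω ρ (f x) (g x) :=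
  (continuous_maxSpeed h).comp₂ hf hg

theorem maxSpeed_add_nat_mul_pi (a b : ℝ) (m n : ℕ) :
    maxSpeed ω ρ (a + m * Real.pi) (b + n * Real.pi) = maxSpeed ω ρ a b := by
  rw [maxSpeed, (ellipseSpeed_periodic _ _).nat_mul m, (ellipseSpeed_periodic _ _).nat_mul n,
    maxSpeed]

variable (ω ρ) in
/-- The average of `maxSpeed` over `[0, T]` along the linear flow started at the angles `a, b`. -/
noncomputable def orbitAverage (a b T : ℝ) : ℝ :=
  1 / T * ∫ t in (0 : ℝ)..T, maxSpeed ω ρ (a + ω.1 * t) (b + ω.2 * t)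

variable (ω ρ) in
/-- The long-time average of `maxSpeed` along the linear flow started at the angles `a, b`. -/
noncomputable def meanSpeed (a b : ℝ) : ℝ :=
  limUnder atTop (orbitAverage ω ρ a b)

variable (ω ρ) in
/-- The supremum of the long-time averages over all initial angles. -/
noncomputable def supMeanSpeed : ℝ :=
  ⨆ x : ℝ × ℝ, meanSpeed ω ρ x.1 x.2

theorem continuous_maxSpeed_orbit (h : (ω, ρ) ∈ parameters) (a b : ℝ) :
    Continuous fun t => maxSpeed ω ρ (a + ω.1 * t) (b + ω.2 * t) :=
  continuous_maxSpeed_comp h (by fun_prop) (by fun_prop)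

/-- Write `T = n P + r` with `0 ≤ r ≤ P`. The `n` full periods cancel, leaving the integral over
`[0, r]` minus `r / P` times the integral over a period; both numbers lie in `[0, C P]`. -/
theorem abs_integral_sub_le_of_periodic {f : ℝ → ℝ} (hf : Continuous f) {P C : ℝ} (hP : 0 < P)
    (per : Function.Periodic f P) (h0 : ∀ t, 0 ≤ f t) (hC : ∀ t, f t ≤ C) (T : ℝ) :
    |(∫ t in (0 : ℝ)..T, f t) - T * (1 / P * ∫ t in (0 : ℝ)..P, f t)| ≤ C * P := by
  have hi : ∀ a b, IntervalIntegrable f volume a b := fun a b => hf.intervalIntegrable a b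
  set n : ℤ := ⌊T / P⌋
  set r : ℝ := T - n * P with hr
  have r0 : 0 ≤ r := by
    have := Int.floor_le (T / P)
    rw [le_div_iff₀ hP] at this
    linarith
  have r1 : r ≤ P := by
    have := (Int.lt_floor_add_one (T / P)).le
    rw [div_le_iff₀ hP] at this
    linarith
  have hbound : ∀ s, 0 ≤ s → 0 ≤ (∫ t in (0 : ℝ)..s, f t) ∧ (∫ t in (0 : ℝ)..s, f t) ≤ C * s := by
    intro s hs
    refine ⟨intervalIntegral.integral_nonneg hs fun t _ => h0 t, ?_⟩
    have := intervalIntegral.integral_mono hs (hi 0 s)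
      (continuous_const.intervalIntegrable (μ := volume) 0 s) fun t => hC t
    simpa [mul_comm] using this
  have e1 : (∫ t in (0 : ℝ)..T, f t) = n * (∫ t in (0 : ℝ)..P, f t) + ∫ t in (0 : ℝ)..r, f t := by
    have a1 := per.intervalIntegral_add_zsmul_eq n 0 hi
    rw [zero_add, zero_add, zsmul_eq_mul, zsmul_eq_mul] at a1
    have a2 : (∫ t in (n * P)..T, f t) = ∫ t in (0 : ℝ)..r, f t := by
      have := intervalIntegral.integral_comp_add_right (a := 0) (b := r) f (n * P)
      rw [zero_add, hr, sub_add_cancel] at this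
      rw [← this]
      refine intervalIntegral.integral_congr fun t _ => ?_
      exact (per.int_mul n t)
    rw [← intervalIntegral.integral_add_adjacent_intervals (hi 0 (n * P)) (hi _ T), a1, a2]
  obtain ⟨b1, b2⟩ := hbound P hP.le
  obtain ⟨b3, b4⟩ := hbound r r0
  set I := ∫ t in (0 : ℝ)..P, f t
  set J := ∫ t in (0 : ℝ)..r, f t
  have e2 : (∫ t in (0 : ℝ)..T, f t) - T * (1 / P * I) = J - r / P * I := by
    rw [e1, hr]; field_simp; ring
  have hC0 : 0 ≤ C := (h0 0).trans (hC 0)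
  have c1 : r / P ≤ 1 := (div_le_one hP).2 r1
  have c0 : 0 ≤ r / P := div_nonneg r0 hP.le
  rw [e2, abs_le]
  constructor
  · nlinarith
  · nlinarith [mul_nonneg c0 b1]

theorem maxSpeed_orbit_periodic (h : (ω, ρ) ∈ parameters) {p q : ℕ} (hq : 0 < q)
    (hpq : ω.2 / ω.1 = (p : ℝ) / q) (a b : ℝ) :
    Function.Periodic (fun t => maxSpeed ω ρ (a + ω.1 * t) (b + ω.2 * t))
      (2 * Real.pi * q / ω.1) := by
  have h1 : 0 < ω.1 := h.1.1
  have hq' : (0 : ℝ) < q := by exact_mod_cast hq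
  intro t
  -- In time `2πq/ω₁` the two angles advance by `2qπ` and `2pπ`, both multiples of the period `π`.
  have e1 : a + ω.1 * (t + 2 * Real.pi * q / ω.1) = a + ω.1 * t + (2 * q : ℕ) * Real.pi := by
    push_cast; field_simp; ring
  have e2 : b + ω.2 * (t + 2 * Real.pi * q / ω.1) = b + ω.2 * t + (2 * p : ℕ) * Real.pi := by
    rw [div_eq_div_iff h1.ne' hq'.ne'] at hpq
    push_cast
    rw [mul_add, mul_div_assoc']
    have : ω.2 * (2 * Real.pi * q) / ω.1 = 2 * p * Real.pi := by
      rw [div_eq_iff h1.ne']; linear_combination 2 * Real.pi * hpq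
    rw [this]; ring
  simp only
  rw [e1, e2, maxSpeed_add_nat_mul_pi]

theorem uniform_average_of_rational (h : (ω, ρ) ∈ parameters) {p q : ℕ} (hq : 0 < q)
    (hpq : ω.2 / ω.1 = (p : ℝ) / q) {ε : ℝ} (hε : 0 < ε) :
    ∃ T₀ > 0, ∀ T ≥ T₀, ∀ a b : ℝ,
      |orbitAverage ω ρ a b T - orbitAverage ω ρ a b (2 * Real.pi * q / ω.1)| ≤ ε := by
  have h1 : 0 < ω.1 := h.1.1
  have hq' : (0 : ℝ) < q := by exact_mod_cast hq
  have hP : 0 < 2 * Real.pi * q / ω.1 := by have := Real.pi_pos; positivity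
  obtain ⟨C, hC, hb⟩ := exists_maxSpeed_le h
  refine ⟨C * (2 * Real.pi * q / ω.1) / ε, by positivity, fun T hT a b => ?_⟩
  have hTpos : 0 < T := lt_of_lt_of_le (by positivity) hT
  have key := abs_integral_sub_le_of_periodic (continuous_maxSpeed_orbit h a b) hP
    (maxSpeed_orbit_periodic h hq hpq a b) (fun t => maxSpeed_nonneg h _ _) (fun t => hb _ _) T
  rw [ge_iff_le, div_le_iff₀ hε] at hT
  rw [orbitAverage, orbitAverage]
  set A := ∫ t in (0 : ℝ)..T, maxSpeed ω ρ (a + ω.1 * t) (b + ω.2 * t)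
  set B := 1 / (2 * Real.pi * q / ω.1) *
    ∫ t in (0 : ℝ)..(2 * Real.pi * q / ω.1), maxSpeed ω ρ (a + ω.1 * t) (b + ω.2 * t)
  have e : 1 / T * A - B = (A - T * B) / T := by field_simp
  rw [e, abs_div, abs_of_pos hTpos, div_le_iff₀ hTpos]
  linarith

theorem uniform_average_of_irrational (h : (ω, ρ) ∈ parameters) (hω : Irrational (ω.2 / ω.1))
    {ε : ℝ} (hε : 0 < ε) :
    ∃ T₀ > 0, ∀ T ≥ T₀, ∀ a b : ℝ, |orbitAverage ω ρ a b T - nonresonantValue ω ρ| ≤ ε :=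
  average_max_of_irrational h.1.1 hω (continuous_ellipseSpeed h.2.1 _)
    (continuous_ellipseSpeed h.2.2 _) (ellipseSpeed_periodic _ _) (ellipseSpeed_periodic _ _) hε

theorem exists_ratio_of_not_irrational (h : (ω, ρ) ∈ parameters)
    (hω : ¬ Irrational (ω.2 / ω.1)) : ∃ p q : ℕ, 0 < q ∧ ω.2 / ω.1 = (p : ℝ) / q := by
  rw [Irrational, not_not] at hω
  obtain ⟨r, hr⟩ := hω
  have hpos : 0 < ω.2 / ω.1 := div_pos h.1.2 h.1.1
  have hr0 : 0 < r := by rw [← hr] at hpos; exact_mod_cast hpos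
  refine ⟨r.num.toNat, r.den, r.pos, ?_⟩
  rw [← hr]
  have hn : ((r.num.toNat : ℤ) : ℝ) = r.num := by
    rw [Int.toNat_of_nonneg (Rat.num_nonneg.2 hr0.le)]
  rw [Int.cast_natCast] at hn
  rw [hn]
  exact_mod_cast (Rat.num_div_den r).symm

theorem tendsto_of_uniform {M a b : ℝ}
    (H : ∀ ε > 0, ∃ T₀ > 0, ∀ T ≥ T₀, |orbitAverage ω ρ a b T - M| ≤ ε) :
    Tendsto (orbitAverage ω ρ a b) atTop (𝓝 M) := by
  rw [Metric.tendsto_atTop]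
  intro ε hε
  obtain ⟨T₀, -, hT⟩ := H (ε / 2) (by positivity)
  refine ⟨T₀, fun T h => ?_⟩
  rw [Real.dist_eq]
  linarith [hT T h]

theorem meanSpeed_of_rational (h : (ω, ρ) ∈ parameters) {p q : ℕ} (hq : 0 < q)
    (hpq : ω.2 / ω.1 = (p : ℝ) / q) (a b : ℝ) :
    meanSpeed ω ρ a b = orbitAverage ω ρ a b (2 * Real.pi * q / ω.1) := by
  refine (tendsto_of_uniform fun ε hε => ?_).limUnder_eq
  obtain ⟨T₀, h0, hT⟩ := uniform_average_of_rational h hq hpq hε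
  exact ⟨T₀, h0, fun T h => hT T h a b⟩

theorem meanSpeed_of_irrational (h : (ω, ρ) ∈ parameters) (hω : Irrational (ω.2 / ω.1))
    (a b : ℝ) : meanSpeed ω ρ a b = nonresonantValue ω ρ := by
  refine (tendsto_of_uniform fun ε hε => ?_).limUnder_eq
  obtain ⟨T₀, h0, hT⟩ := uniform_average_of_irrational h hω hε
  exact ⟨T₀, h0, fun T h => hT T h a b⟩

/-- That a single `T₀` serves all initial angles is what the proof of upper semicontinuity uses. -/
theorem uniform_average (h : (ω, ρ) ∈ parameters) {ε : ℝ} (hε : 0 < ε) :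
    ∃ T₀ > 0, ∀ T ≥ T₀, ∀ a b : ℝ, |orbitAverage ω ρ a b T - meanSpeed ω ρ a b| ≤ ε := by
  by_cases hω : Irrational (ω.2 / ω.1)
  · simpa only [meanSpeed_of_irrational h hω] using uniform_average_of_irrational h hω hε
  · obtain ⟨p, q, hq, hpq⟩ := exists_ratio_of_not_irrational h hω
    simpa only [meanSpeed_of_rational h hq hpq] using uniform_average_of_rational h hq hpq hε

theorem tendsto_orbitAverage (h : (ω, ρ) ∈ parameters) (a b : ℝ) :
    Tendsto (orbitAverage ω ρ a b) atTop (𝓝 (meanSpeed ω ρ a b)) := by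
  refine tendsto_of_uniform fun ε hε => ?_
  obtain ⟨T₀, h0, hT⟩ := uniform_average h hε
  exact ⟨T₀, h0, fun T h => hT T h a b⟩

theorem orbitAverage_nonneg (h : (ω, ρ) ∈ parameters) (a b : ℝ) {T : ℝ} (hT : 0 < T) :
    0 ≤ orbitAverage ω ρ a b T :=
  mul_nonneg (by positivity)
    (intervalIntegral.integral_nonneg hT.le fun _ _ => maxSpeed_nonneg h _ _)

theorem meanSpeed_nonneg (h : (ω, ρ) ∈ parameters) (a b : ℝ) : 0 ≤ meanSpeed ω ρ a b :=
  ge_of_tendsto (tendsto_orbitAverage h a b)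
    ((eventually_gt_atTop 0).mono fun _ hT => orbitAverage_nonneg h a b hT)

/-- Each of the `n` pieces of length `T` is an orbit segment restarted at the angles reached so far,
which is why the bound `H` is required for all initial angles. -/
theorem integral_le_of_orbitAverage_le (h : (ω, ρ) ∈ parameters) {c T : ℝ} (hT : 0 < T)
    (H : ∀ a b, orbitAverage ω ρ a b T ≤ c) (n : ℕ) (a b : ℝ) :
    ∫ t in (0 : ℝ)..(n * T), maxSpeed ω ρ (a + ω.1 * t) (b + ω.2 * t) ≤ n * T * c := by
  induction n with
  | zero => simp
  | succ n ih =>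
    have hi := fun x y => (continuous_maxSpeed_orbit h a b).intervalIntegrable (μ := volume) x y
    rw [← intervalIntegral.integral_add_adjacent_intervals (hi 0 (n * T)) (hi _ _)]
    have e := intervalIntegral.integral_comp_add_right (a := 0) (b := T)
      (fun t => maxSpeed ω ρ (a + ω.1 * t) (b + ω.2 * t)) (n * T)
    have e' : (n : ℝ) * T + T = ((n + 1 : ℕ) : ℝ) * T := by push_cast; ring
    rw [zero_add, add_comm T, e'] at e
    have k := H (a + ω.1 * (n * T)) (b + ω.2 * (n * T))
    rw [orbitAverage, one_div, inv_mul_le_iff₀ hT] at k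
    have e2 : (∫ t in (0 : ℝ)..T, maxSpeed ω ρ (a + ω.1 * (n * T) + ω.1 * t)
        (b + ω.2 * (n * T) + ω.2 * t)) =
        ∫ t in (0 : ℝ)..T, maxSpeed ω ρ (a + ω.1 * (t + n * T)) (b + ω.2 * (t + n * T)) :=
      intervalIntegral.integral_congr fun t _ => by
        congr 1 <;> ring
    rw [e2, e] at k
    push_cast at k ih ⊢
    linarith

theorem meanSpeed_le_of_orbitAverage_le (h : (ω, ρ) ∈ parameters) {c T : ℝ} (hT : 0 < T)
    (H : ∀ a b, orbitAverage ω ρ a b T ≤ c) (a b : ℝ) : meanSpeed ω ρ a b ≤ c := by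
  have ht : Tendsto (fun n : ℕ => (n : ℝ) * T) atTop atTop :=
    tendsto_natCast_atTop_atTop.atTop_mul_const hT
  refine le_of_tendsto ((tendsto_orbitAverage h a b).comp ht) ?_
  filter_upwards [eventually_gt_atTop 0] with n hn
  have hn' : (0 : ℝ) < n := by exact_mod_cast hn
  simp only [Function.comp_apply]
  rw [orbitAverage, one_div, inv_mul_le_iff₀ (by positivity)]
  exact integral_le_of_orbitAverage_le h hT H n a b

theorem bddAbove_meanSpeed (h : (ω, ρ) ∈ parameters) :
    BddAbove (range fun x : ℝ × ℝ => meanSpeed ω ρ x.1 x.2) := by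
  obtain ⟨C, hC, hb⟩ := exists_maxSpeed_le h
  refine ⟨C, ?_⟩
  rintro _ ⟨x, rfl⟩
  refine meanSpeed_le_of_orbitAverage_le h one_pos (fun a b => ?_) _ _
  rw [orbitAverage, div_one, one_mul]
  have := intervalIntegral.integral_mono zero_le_one
    ((continuous_maxSpeed_orbit h a b).intervalIntegrable 0 1)
      (continuous_const.intervalIntegrable (μ := volume) 0 1) fun t => hb _ _
  simpa using this

theorem meanSpeed_le_supMeanSpeed (h : (ω, ρ) ∈ parameters) (a b : ℝ) :
    meanSpeed ω ρ a b ≤ supMeanSpeed ω ρ :=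
  le_ciSup (bddAbove_meanSpeed h) (a, b)

theorem supMeanSpeed_of_irrational (h : (ω, ρ) ∈ parameters) (hω : Irrational (ω.2 / ω.1)) :
    supMeanSpeed ω ρ = nonresonantValue ω ρ := by
  simp [supMeanSpeed, meanSpeed_of_irrational h hω]

theorem orbitAverage_add_int_mul_pi (a b T : ℝ) (m n : ℤ) :
    orbitAverage ω ρ (a - m * Real.pi) (b - n * Real.pi) T = orbitAverage ω ρ a b T := by
  rw [orbitAverage, orbitAverage]
  congr 1
  refine intervalIntegral.integral_congr fun t _ => ?_
  simp only [maxSpeed]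
  congr 1
  · rw [← (ellipseSpeed_periodic ρ.1 ω.1).int_mul m]; congr 1; ring
  · rw [← (ellipseSpeed_periodic ρ.2 ω.2).int_mul n]; congr 1; ring

theorem sub_floor_mul_pi_mem (a : ℝ) : a - ⌊a / Real.pi⌋ * Real.pi ∈ Icc 0 Real.pi := by
  have hp := Real.pi_pos
  have h1 := Int.floor_le (a / Real.pi)
  have h2 := (Int.lt_floor_add_one (a / Real.pi)).le
  rw [le_div_iff₀ hp] at h1
  rw [div_le_iff₀ hp] at h2
  constructor <;> linarith

/-! ### Upper semicontinuity -/

theorem upperSemicontinuousOn_supMeanSpeed :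
    UpperSemicontinuousOn (fun x : (ℝ × ℝ) × (ℝ × ℝ) => supMeanSpeed x.1 x.2) parameters := by
  rintro ⟨ω₀, ρ₀⟩ h₀ c hc
  simp only at hc
  -- The gap below `c` is split in thirds: one for replacing the limit by the average over `[0, T]`,
  -- one for the strict inequality with `c'`, one left between `c'` and `c`.
  obtain ⟨T, hT, HT⟩ := uniform_average h₀ (ε := (c - supMeanSpeed ω₀ ρ₀) / 3) (by linarith)
  set c' := supMeanSpeed ω₀ ρ₀ + 2 * ((c - supMeanSpeed ω₀ ρ₀) / 3) with hc'
  have hcont : Continuous fun y : parameters × (ℝ × ℝ) =>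
      orbitAverage y.1.1.1 y.1.1.2 y.2.1 y.2.2 T := by
    unfold orbitAverage maxSpeed ellipseSpeed
    refine continuous_const.mul
      (intervalIntegral.continuous_parametric_intervalIntegral_of_continuous' ?_ _ _)
    refine Continuous.max ?_ ?_
    · exact Continuous.div (by fun_prop) (by fun_prop)
        fun y => (ellipse_denom_pos y.1.1.2.2.1 _).ne'
    · exact Continuous.div (by fun_prop) (by fun_prop)
        fun y => (ellipse_denom_pos y.1.1.2.2.2 _).ne'
  -- Compactness of the square of angles makes one neighbourhood of the parameters work for all of
  -- them; periodicity later reduces arbitrary angles to this square.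
  have ev : ∀ᶠ x : parameters in 𝓝 ⟨(ω₀, ρ₀), h₀⟩, ∀ y ∈ Icc 0 Real.pi ×ˢ Icc 0 Real.pi,
      orbitAverage x.1.1 x.1.2 y.1 y.2 T < c' := by
    refine (isCompact_Icc.prod isCompact_Icc).eventually_forall_of_forall_eventually
      (P := fun (x : parameters) (y : ℝ × ℝ) => orbitAverage x.1.1 x.1.2 y.1 y.2 T < c')
      fun y _ => ?_
    refine hcont.continuousAt.eventually (gt_mem_nhds ?_)
    have e1 := (abs_le.1 (HT T le_rfl y.1 y.2)).2
    have e2 := meanSpeed_le_supMeanSpeed h₀ y.1 y.2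
    simp only
    linarith
  rw [nhdsWithin_eq_map_subtype_coe h₀, eventually_map]
  filter_upwards [ev] with x hx
  have hle : supMeanSpeed x.1.1 x.1.2 ≤ c' := by
    refine ciSup_le fun y => meanSpeed_le_of_orbitAverage_le x.2 hT (fun a b => ?_) _ _
    rw [← orbitAverage_add_int_mul_pi a b T ⌊a / Real.pi⌋ ⌊b / Real.pi⌋]
    exact (hx (_, _) ⟨sub_floor_mul_pi_mem a, sub_floor_mul_pi_mem b⟩).le
  exact hle.trans_lt (by linarith)

/-! ### The resonant formula -/

/-- Since `E_1` has period `π`, its argument may be shifted by `2π(j - 1)` as well. The `q` summands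
then are the integrals of one function over adjacent windows filling `[0, 2πq]`, and the
substitution `s = ω₁ r` turns this into the average over one period of the orbit. -/
theorem resonantL_eq_meanSpeed (h : (ω, ρ) ∈ parameters) {p q : ℕ} (hq : 0 < q)
    (hpq : ω.2 / ω.1 = (p : ℝ) / q) (t : ℝ) : resonantL ω ρ p q t = meanSpeed ω ρ t 0 := by
  have h1 : 0 < ω.1 := h.1.1
  have hq' : (0 : ℝ) < q := by exact_mod_cast hq
  rw [meanSpeed_of_rational h hq hpq, orbitAverage, resonantL]
  set H : ℝ → ℝ := fun s => maxSpeed ω ρ (t + s) ((p : ℝ) / q * s) with hH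
  have cH : Continuous H := continuous_maxSpeed_comp h (by fun_prop) (by fun_prop)
  have e1 : ∀ j ∈ Finset.Icc 1 q, ∀ τ, max (ellipseSpeed ρ.1 ω.1 (t + τ))
      (ellipseSpeed ρ.2 ω.2 ((p : ℝ) / q * (τ + 2 * Real.pi * ((j : ℝ) - 1)))) =
      H (τ + 2 * Real.pi * ((j : ℝ) - 1)) := by
    intro j hj τ
    obtain ⟨k, rfl⟩ : ∃ k, j = k + 1 := ⟨j - 1, by have := (Finset.mem_Icc.1 hj).1; omega⟩
    simp only [hH, maxSpeed]
    congr 1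
    have : t + (τ + 2 * Real.pi * (((k + 1 : ℕ) : ℝ) - 1)) = t + τ + (2 * k : ℕ) * Real.pi := by
      push_cast; ring
    rw [this, (ellipseSpeed_periodic ρ.1 ω.1).nat_mul]
  have e2 : (∫ τ in (0 : ℝ)..(2 * Real.pi), ∑ j ∈ Finset.Icc 1 q,
      max (ellipseSpeed ρ.1 ω.1 (t + τ))
        (ellipseSpeed ρ.2 ω.2 ((p : ℝ) / q * (τ + 2 * Real.pi * ((j : ℝ) - 1))))) =
      ∫ s in (0 : ℝ)..(2 * Real.pi * q), H s := by
    calc _ = ∫ τ in (0 : ℝ)..(2 * Real.pi), ∑ j ∈ Finset.Icc 1 q,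
          H (τ + 2 * Real.pi * ((j : ℝ) - 1)) :=
        intervalIntegral.integral_congr fun τ _ => Finset.sum_congr rfl fun j hj => e1 j hj τ
      _ = ∑ j ∈ Finset.Icc 1 q, ∫ τ in (0 : ℝ)..(2 * Real.pi),
          H (τ + 2 * Real.pi * ((j : ℝ) - 1)) :=
        intervalIntegral.integral_finsetSum fun j _ =>
          (cH.comp (by fun_prop)).intervalIntegrable _ _
      _ = ∑ k ∈ Finset.range q, ∫ τ in (2 * Real.pi * (k : ℕ))..(2 * Real.pi * (k + 1 : ℕ)), H τ := by
        have : Finset.Icc 1 q = Finset.Ico (0 + 1) (q + 1) := by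
          ext j; simp only [Finset.mem_Icc, Finset.mem_Ico]; omega
        rw [this, ← Finset.sum_Ico_add' _ 0 q 1, Finset.range_eq_Ico]
        refine Finset.sum_congr rfl fun k _ => ?_
        rw [intervalIntegral.integral_comp_add_right]
        congr 1 <;> (push_cast; ring)
      _ = _ := by
        rw [intervalIntegral.sum_integral_adjacent_intervals (a := fun k : ℕ => 2 * Real.pi * (k : ℝ))
          fun k _ => cH.intervalIntegrable _ _]
        simp
  have e3 : (∫ s in (0 : ℝ)..(2 * Real.pi * q), H s) =
      ω.1 * ∫ r in (0 : ℝ)..(2 * Real.pi * q / ω.1), maxSpeed ω ρ (t + ω.1 * r) (0 + ω.2 * r) := by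
    have := intervalIntegral.mul_integral_comp_mul_left (a := 0) (b := 2 * Real.pi * q / ω.1)
      (f := H) ω.1
    rw [mul_zero, mul_div_cancel₀ _ h1.ne'] at this
    rw [← this]
    congr 1
    refine intervalIntegral.integral_congr fun r _ => ?_
    simp only [hH]
    congr 1
    rw [← hpq]; field_simp; ring
  rw [e2, e3]
  have hp := Real.pi_pos
  have e4 : 1 / (2 * Real.pi * q / ω.1) = 1 / (2 * Real.pi * q) * ω.1 := by field_simp
  rw [e4, mul_assoc (1 / (2 * Real.pi * (q : ℝ)))]

theorem meanSpeed_shift_of_rational (h : (ω, ρ) ∈ parameters) {p q : ℕ} (hq : 0 < q)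
    (hpq : ω.2 / ω.1 = (p : ℝ) / q) (a b s : ℝ) :
    meanSpeed ω ρ (a + ω.1 * s) (b + ω.2 * s) = meanSpeed ω ρ a b := by
  rw [meanSpeed_of_rational h hq hpq, meanSpeed_of_rational h hq hpq, orbitAverage, orbitAverage]
  congr 1
  set P := 2 * Real.pi * q / ω.1
  have per := maxSpeed_orbit_periodic h hq hpq a b
  have e := per.intervalIntegral_add_eq s 0
  rw [zero_add] at e
  rw [← e]
  have e2 := intervalIntegral.integral_comp_add_right (a := 0) (b := P)
      (fun t => maxSpeed ω ρ (a + ω.1 * t) (b + ω.2 * t)) s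
  rw [zero_add, add_comm P] at e2
  rw [← e2]
  refine intervalIntegral.integral_congr fun t _ => ?_
  congr 1 <;> ring

theorem isLUB_resonantL (h : (ω, ρ) ∈ parameters) {p q : ℕ} (hq : 0 < q)
    (hpq : ω.2 / ω.1 = (p : ℝ) / q) :
    IsLUB (resonantL ω ρ p q '' Icc 0 (2 * Real.pi)) (supMeanSpeed ω ρ) := by
  have h2 : 0 < ω.2 := h.1.2
  constructor
  · rintro _ ⟨t, _, rfl⟩
    rw [resonantL_eq_meanSpeed h hq hpq]
    exact meanSpeed_le_supMeanSpeed h t 0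
  · intro u hu
    refine ciSup_le fun x => ?_
    -- The mean is constant along orbits, and at time `-x.2 / ω.2` the orbit has second angle zero;
    -- so only the phase of the first angle matters.
    have e1 := meanSpeed_shift_of_rational h hq hpq x.1 x.2 (-(x.2 / ω.2))
    have e2 : x.2 + ω.2 * -(x.2 / ω.2) = 0 := by field_simp; ring
    rw [e2] at e1
    rw [← e1]
    set a := x.1 + ω.1 * -(x.2 / ω.2)
    have e3 : meanSpeed ω ρ a 0 = meanSpeed ω ρ (a - ⌊a / Real.pi⌋ * Real.pi) 0 := by
      rw [meanSpeed_of_rational h hq hpq, meanSpeed_of_rational h hq hpq,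
        ← orbitAverage_add_int_mul_pi a 0 _ ⌊a / Real.pi⌋ 0]
      simp
    rw [e3, ← resonantL_eq_meanSpeed h hq hpq]
    have hm := sub_floor_mul_pi_mem a
    exact hu ⟨_, ⟨hm.1, hm.2.trans (by linarith [Real.pi_pos])⟩, rfl⟩

end

/-! ### Failure of lower semicontinuity -/

theorem nonresonantValue_mono {ω ω' ρ : ℝ × ℝ} (h : (ω, ρ) ∈ parameters)
    (h' : (ω', ρ) ∈ parameters) (h1 : ω.1 ≤ ω'.1) (h2 : ω.2 ≤ ω'.2) :
    nonresonantValue ω ρ ≤ nonresonantValue ω' ρ := by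
  have hi : ∀ {ω : ℝ × ℝ}, (ω, ρ) ∈ parameters →
      IntegrableOn (fun τ : ℝ × ℝ => maxSpeed ω ρ τ.1 τ.2) (Icc 0 Real.pi ×ˢ Icc 0 Real.pi) :=
    fun h => (continuous_maxSpeed h).continuousOn.integrableOn_compact
      (isCompact_Icc.prod isCompact_Icc)
  exact mul_le_mul_of_nonneg_left (integral_mono (hi h) (hi h') fun τ =>
    max_le_max (ellipseSpeed_mono h.2.1 h1 _) (ellipseSpeed_mono h.2.2 h2 _)) (by positivity)

/-- For equal frequencies the torus is foliated by the diagonal orbits, and `L t` is the mean over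
the orbit with phase `t`. Fubini and the translation `t ↦ t + τ`, harmless by periodicity, give the
torus mean as the mean of `L`. -/
theorem nonresonantValue_eq_integral_resonantL {ρ : ℝ × ℝ} (h : ((1, 1), ρ) ∈ parameters) :
    nonresonantValue (1, 1) ρ =
      1 / Real.pi * ∫ t in (0 : ℝ)..Real.pi, resonantL (1, 1) ρ 1 1 t := by
  have hp := Real.pi_pos
  set g : ℝ → ℝ → ℝ := fun t τ => maxSpeed (1, 1) ρ (t + τ) τ with hg
  have cg : Continuous fun x : ℝ × ℝ => g x.1 x.2 :=
    continuous_maxSpeed_comp h (by fun_prop) (by fun_prop)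
  have hL : ∀ t, resonantL (1, 1) ρ 1 1 t = 1 / Real.pi * ∫ τ in (0 : ℝ)..Real.pi, g t τ := by
    intro t
    have per : Function.Periodic (g t) Real.pi := by
      intro τ
      have := maxSpeed_add_nat_mul_pi (ω := (1, 1)) (ρ := ρ) (t + τ) τ 1 1
      rw [Nat.cast_one, one_mul] at this
      simp only [hg]
      rw [← this]; congr 1; ring
    have ci : ∀ a b, IntervalIntegrable (g t) volume a b := fun a b =>
      (continuous_maxSpeed_comp h (by fun_prop) (by fun_prop)).intervalIntegrable a b
    have e1 : (∫ τ in (0 : ℝ)..(2 * Real.pi), g t τ) = 2 * ∫ τ in (0 : ℝ)..Real.pi, g t τ := by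
      have := per.intervalIntegral_add_zsmul_eq 2 0 ci
      simpa using this
    have e2 : resonantL (1, 1) ρ 1 1 t = 1 / (2 * Real.pi) * ∫ τ in (0 : ℝ)..(2 * Real.pi), g t τ := by
      simp [resonantL, hg, maxSpeed]
    rw [e2, e1]; field_simp
  simp only [hL]
  rw [intervalIntegral.integral_const_mul, ← mul_assoc, nonresonantValue]
  have e3 : (∫ t in (0 : ℝ)..Real.pi, ∫ τ in (0 : ℝ)..Real.pi, g t τ) =
      ∫ τ in (0 : ℝ)..Real.pi, ∫ t in (0 : ℝ)..Real.pi, g t τ := by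
    simp only [intervalIntegral.integral_of_le hp.le, ← integral_Icc_eq_integral_Ioc]
    refine integral_integral_swap ?_
    rw [Measure.prod_restrict]
    exact cg.continuousOn.integrableOn_compact (isCompact_Icc.prod isCompact_Icc)
  have e4 : ∀ τ, (∫ t in (0 : ℝ)..Real.pi, g t τ) =
      ∫ t in (0 : ℝ)..Real.pi, maxSpeed (1, 1) ρ t τ := by
    intro τ
    have per : Function.Periodic (fun t => maxSpeed (1, 1) ρ t τ) Real.pi := by
      intro t
      simpa using maxSpeed_add_nat_mul_pi (ω := (1, 1)) (ρ := ρ) t τ 1 0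
    have := per.intervalIntegral_add_eq τ 0
    rw [zero_add] at this
    rw [← this, add_comm τ, hg]
    have e := intervalIntegral.integral_comp_add_right (a := 0) (b := Real.pi)
      (fun t => maxSpeed (1, 1) ρ t τ) τ
    rw [zero_add] at e
    exact e
  have e5 : (∫ τ in Icc 0 Real.pi ×ˢ Icc 0 Real.pi, maxSpeed (1, 1) ρ τ.1 τ.2) =
      ∫ t in (0 : ℝ)..Real.pi, ∫ τ in (0 : ℝ)..Real.pi, maxSpeed (1, 1) ρ t τ := by
    rw [Measure.volume_eq_prod, setIntegral_prod]
    · simp only [intervalIntegral.integral_of_le hp.le, ← integral_Icc_eq_integral_Ioc]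
    · exact (continuous_maxSpeed h).continuousOn.integrableOn_compact
        (isCompact_Icc.prod isCompact_Icc)
  have e6 : (∫ t in (0 : ℝ)..Real.pi, ∫ τ in (0 : ℝ)..Real.pi, maxSpeed (1, 1) ρ t τ) =
      ∫ τ in (0 : ℝ)..Real.pi, ∫ t in (0 : ℝ)..Real.pi, maxSpeed (1, 1) ρ t τ := by
    simp only [intervalIntegral.integral_of_le hp.le, ← integral_Icc_eq_integral_Ioc]
    refine integral_integral_swap ?_
    rw [Measure.prod_restrict]
    exact (continuous_maxSpeed h).continuousOn.integrableOn_compact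
      (isCompact_Icc.prod isCompact_Icc)
  rw [e3]
  simp only [e4]
  rw [← e6, ← e5]
  simp only [maxSpeed]
  congr 1
  field_simp

theorem continuous_resonantL {ω ρ : ℝ × ℝ} (h : (ω, ρ) ∈ parameters) (p q : ℕ) :
    Continuous (resonantL ω ρ p q) := by
  unfold resonantL
  refine continuous_const.mul
    (intervalIntegral.continuous_parametric_intervalIntegral_of_continuous' ?_ _ _)
  have c1 := continuous_ellipseSpeed h.2.1 ω.1
  have c2 := continuous_ellipseSpeed h.2.2 ω.2
  simp only at c1 c2
  fun_prop

theorem mem_parameters_one_third {κ : ℝ} (hκ : 0 < κ) :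
    (((1, κ), (1 / 3, 1 / 3)) : (ℝ × ℝ) × (ℝ × ℝ)) ∈ parameters := by
  refine ⟨⟨?_, hκ⟩, ⟨?_, ?_⟩, ?_, ?_⟩ <;> simp only [mem_Ioi] <;> norm_num

theorem nonresonantValue_lt_supMeanSpeed :
    nonresonantValue (1, 1) (1 / 3, 1 / 3) < supMeanSpeed (1, 1) (1 / 3, 1 / 3) := by
  have hp := Real.pi_pos
  have h := mem_parameters_one_third one_pos
  have hρ : (1 / 3 : ℝ) ∈ Ioc (0 : ℝ) 1 := h.2.1
  set L := resonantL (1, 1) (1 / 3, 1 / 3) 1 1 with hL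
  have hlub := isLUB_resonantL h (p := 1) (q := 1) one_pos (by simp)
  have hle : ∀ t ∈ Icc 0 Real.pi, L t ≤ supMeanSpeed (1, 1) (1 / 3, 1 / 3) := fun t ht =>
    hlub.1 ⟨t, ⟨ht.1, ht.2.trans (by linarith)⟩, rfl⟩
  have e : ∀ t, L t = 1 / (2 * Real.pi) * ∫ τ in (0 : ℝ)..(2 * Real.pi),
      max (ellipseSpeed (1 / 3) 1 (t + τ)) (ellipseSpeed (1 / 3) 1 τ) := by
    intro t; simp [hL, resonantL]
  have cE := continuous_ellipseSpeed hρ 1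
  -- At phase `0` the two speeds coincide, so the maximum is just `E`. At phase `π/2` the integrand
  -- is nowhere smaller, and at `τ = 0` it is `E(π/2) = 3` instead of `E(0) = 1/3`. Thus `L` is not
  -- constant.
  have hlt : L 0 < L (Real.pi / 2) := by
    rw [e, e]
    refine mul_lt_mul_of_pos_left ?_ (by positivity)
    refine intervalIntegral.integral_lt_integral_of_continuousOn_of_le_of_exists_lt (by positivity)
      (by fun_prop) (by fun_prop) (fun τ _ => by simp) ⟨0, ⟨le_rfl, by positivity⟩, ?_⟩
    simp [ellipseSpeed]
  have h0 : L 0 < supMeanSpeed (1, 1) (1 / 3, 1 / 3) :=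
    hlt.trans_le (hle _ ⟨by linarith, by linarith⟩)
  rw [nonresonantValue_eq_integral_resonantL h]
  have key : (∫ t in (0 : ℝ)..Real.pi, L t) <
      ∫ _ in (0 : ℝ)..Real.pi, supMeanSpeed (1, 1) (1 / 3, 1 / 3) :=
    intervalIntegral.integral_lt_integral_of_continuousOn_of_le_of_exists_lt hp
      (continuous_resonantL h 1 1).continuousOn continuousOn_const
      (fun t ht => hle t ⟨ht.1.le, ht.2⟩) ⟨0, ⟨le_rfl, hp.le⟩, h0⟩
  rw [intervalIntegral.integral_const, sub_zero, smul_eq_mul] at key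
  rw [one_div, inv_mul_lt_iff₀ hp]
  exact key

theorem not_lowerSemicontinuousOn_supMeanSpeed :
    ¬ LowerSemicontinuousOn (fun x : ℝ × ℝ => supMeanSpeed (1, x.1) (1 / 3, x.2))
        (Ioc 0 1 ×ˢ Ioc 0 1) := by
  intro H
  have hmem : ((1, 1 / 3) : ℝ × ℝ) ∈ Ioc (0 : ℝ) 1 ×ˢ Ioc (0 : ℝ) 1 := by
    constructor <;> constructor <;> norm_num
  have ev := H _ hmem _ nonresonantValue_lt_supMeanSpeed
  rw [eventually_iff, Metric.mem_nhdsWithin_iff] at ev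
  obtain ⟨ε, hε, hsub⟩ := ev
  -- Taking `κ` below `1` lets monotonicity in `ω` bound the nonresonant value, so no continuity in
  -- `κ` is needed.
  obtain ⟨κ, hκ, h1, h2⟩ := exists_irrational_btwn (show max (1 - ε) 0 < 1 from
    max_lt (by linarith) one_pos)
  have hκ0 : 0 < κ := (le_max_right _ _).trans_lt h1
  have hκε : 1 - ε < κ := (le_max_left _ _).trans_lt h1
  have hin : ((κ, 1 / 3) : ℝ × ℝ) ∈ Metric.ball ((1, 1 / 3) : ℝ × ℝ) ε ∩
      Ioc (0 : ℝ) 1 ×ˢ Ioc (0 : ℝ) 1 := by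
    refine ⟨?_, ⟨hκ0, h2.le⟩, hmem.2⟩
    rw [Metric.mem_ball, Prod.dist_eq]
    simp only [dist_self, Real.dist_eq]
    rw [max_lt_iff, abs_lt]
    exact ⟨⟨by linarith, by linarith⟩, hε⟩
  have hlt := hsub hin
  simp only [mem_ofPred_eq] at hlt
  have hpar := mem_parameters_one_third hκ0
  rw [supMeanSpeed_of_irrational hpar (by simpa using hκ)] at hlt
  exact absurd hlt (not_lt.2 (nonresonantValue_mono hpar (mem_parameters_one_third one_pos)
    le_rfl h2.le))

/-! ### Perturbation of orthogonal projections and of angular speeds -/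

section Euclidean

variable {E : Type*} [NormedAddCommGroup E] [InnerProductSpace ℝ E] [FiniteDimensional ℝ E]

theorem norm_sub_starProjection_le (K : Submodule ℝ E) (x : E) : ‖x - K.starProjection x‖ ≤ ‖x‖ := by
  rw [← Submodule.starProjection_orthogonal_val]
  exact Kᗮ.norm_starProjection_apply_le x

theorem norm_sub_starProjection_le_of_mem (K : Submodule ℝ E) (x : E) {z : E} (hz : z ∈ K) :
    ‖x - K.starProjection x‖ ≤ ‖x - z‖ := by
  have e : x - K.starProjection x = (x - z) - K.starProjection (x - z) := by
    rw [map_sub, Submodule.starProjection_eq_self_iff.2 hz]; abel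
  rw [e]
  exact norm_sub_starProjection_le K _

/-- Orthogonal projections depend on the subspace in a Lipschitz way. -/
theorem norm_starProjection_map_sub_le {W W' : Submodule ℝ E} {T : E →L[ℝ] E}
    (hW : W' = W.map T.toLinearMap) :
    ‖W'.starProjection - W.starProjection‖ ≤ 4 * ‖T - ContinuousLinearMap.id ℝ E‖ := by
  set ε := ‖T - ContinuousLinearMap.id ℝ E‖ with hε
  have hε0 : 0 ≤ ε := norm_nonneg _
  -- For `ε ≥ 1/2` the trivial bound `2 ≤ 4 ε` suffices; for `ε < 1/2` the map `T` shrinks norms by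
  -- at most a factor `2`.
  by_cases hε1 : 1 / 2 ≤ ε
  · have := norm_sub_le W'.starProjection W.starProjection
    have h1 := W'.starProjection_norm_le
    have h2 := W.starProjection_norm_le
    linarith
  rw [not_le] at hε1
  have hT : ∀ w, ‖T w - w‖ ≤ ε * ‖w‖ := fun w =>
    (T - ContinuousLinearMap.id ℝ E).le_opNorm w
  have h1 : ∀ w ∈ W, ‖w - W'.starProjection w‖ ≤ ε * ‖w‖ := fun w hw =>
    (norm_sub_starProjection_le_of_mem W' w (hW ▸ Submodule.mem_map_of_mem hw)).trans
      (by rw [norm_sub_rev]; exact hT w)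
  have h2 : ∀ w ∈ W', ‖w - W.starProjection w‖ ≤ 2 * ε * ‖w‖ := by
    intro w' hw'
    rw [hW] at hw'
    obtain ⟨w, hw, rfl⟩ := hw'
    have a1 := norm_sub_starProjection_le_of_mem W (T w) hw
    have a2 := hT w
    have a3 : ‖w‖ ≤ 2 * ‖T w‖ := by
      have : ‖w‖ ≤ ‖T w‖ + ‖T w - w‖ := by
        have := norm_sub_le (T w) (T w - w)
        rwa [sub_sub_cancel] at this
      nlinarith [norm_nonneg w]
    calc _ ≤ ε * ‖w‖ := a1.trans a2
      _ ≤ ε * (2 * ‖T w‖) := by gcongr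
      _ = _ := by simp; ring
  -- Duality: for `y` orthogonal to `W` and `z = P' y` one has `‖z‖² = ⟪z, y⟫ = ⟪z - P z, y⟫`, and
  -- `h2` controls `z - P z`.
  have h3 : ∀ y, W.starProjection y = 0 → ‖W'.starProjection y‖ ≤ 2 * ε * ‖y‖ := by
    intro y hy
    set z := W'.starProjection y with hz
    have hzW : z ∈ W' := W'.starProjection_apply_mem y
    have e1 : ‖z‖ * ‖z‖ = inner ℝ (z - W.starProjection z) y := by
      rw [inner_sub_left, W.inner_starProjection_left_eq_right, hy, inner_zero_right, sub_zero,
        ← real_inner_self_eq_norm_mul_norm]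
      have := W'.starProjection_inner_eq_zero y z hzW
      rw [inner_sub_left, sub_eq_zero] at this
      rw [← hz] at this
      rw [← this, real_inner_comm]
    have e2 : ‖z‖ * ‖z‖ ≤ 2 * ε * ‖z‖ * ‖y‖ := by
      rw [e1]
      exact (real_inner_le_norm _ _).trans
        (mul_le_mul_of_nonneg_right (h2 z hzW) (norm_nonneg y))
    rcases (norm_nonneg z).eq_or_lt with h | h
    · rw [← h]; positivity
    · exact le_of_mul_le_mul_right (by linarith) h
  refine ContinuousLinearMap.opNorm_le_bound _ (by positivity) fun x => ?_
  -- `P' - P = P'(1 - P) - (1 - P')P`; the two terms contribute `2 ε` and `ε`.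
  have d : W'.starProjection x - W.starProjection x =
      W'.starProjection (x - W.starProjection x) -
        (W.starProjection x - W'.starProjection (W.starProjection x)) := by
    rw [map_sub]; abel
  rw [sub_apply, d]
  have b1 := h1 (W.starProjection x) (W.starProjection_apply_mem x)
  have b2 := h3 (x - W.starProjection x) (by
    rw [map_sub, W.starProjection_eq_self_iff.2 (W.starProjection_apply_mem x), sub_self])
  have b3 := W.norm_starProjection_apply_le x
  have b4 := norm_sub_starProjection_le W x
  calc _ ≤ _ := norm_sub_le _ _
    _ ≤ 2 * ε * ‖x‖ + ε * ‖x‖ := add_le_add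
      (b2.trans (by gcongr)) (b1.trans (by gcongr))
    _ ≤ 4 * ε * ‖x‖ := by nlinarith [norm_nonneg x, mul_nonneg hε0 (norm_nonneg x)]

theorem norm_id_sub_starProjection_le (K : Submodule ℝ E) :
    ‖ContinuousLinearMap.id ℝ E - K.starProjection‖ ≤ 1 :=
  ContinuousLinearMap.opNorm_le_bound _ zero_le_one fun x => by
    rw [one_mul]; exact norm_sub_starProjection_le K x

/-- Telescoping: `(1 - P)AP - (1 - Q)AQ = (1 - P)A(P - Q) - (P - Q)AQ`, where the outer projections
have norm at most one. -/
theorem abs_norm_comp_sub_le (A : E →L[ℝ] E) (K L : Submodule ℝ E) :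
    |‖(ContinuousLinearMap.id ℝ E - K.starProjection) ∘L A ∘L K.starProjection‖ -
      ‖(ContinuousLinearMap.id ℝ E - L.starProjection) ∘L A ∘L L.starProjection‖| ≤
      2 * ‖A‖ * ‖K.starProjection - L.starProjection‖ := by
  refine (abs_norm_sub_norm_le _ _).trans ?_
  have e : (ContinuousLinearMap.id ℝ E - K.starProjection) ∘L A ∘L K.starProjection -
      (ContinuousLinearMap.id ℝ E - L.starProjection) ∘L A ∘L L.starProjection =
      (ContinuousLinearMap.id ℝ E - K.starProjection) ∘L A ∘L
        (K.starProjection - L.starProjection) -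
      (K.starProjection - L.starProjection) ∘L A ∘L L.starProjection := by
    ext x
    simp only [sub_apply, ContinuousLinearMap.comp_apply,
      ContinuousLinearMap.id_apply, map_sub]
    abel
  rw [e]
  have h1 : ‖(ContinuousLinearMap.id ℝ E - K.starProjection) ∘L A ∘L
      (K.starProjection - L.starProjection)‖ ≤ 1 * (‖A‖ * ‖K.starProjection - L.starProjection‖) :=
    (ContinuousLinearMap.opNorm_comp_le _ _).trans (mul_le_mul (norm_id_sub_starProjection_le K)
      (ContinuousLinearMap.opNorm_comp_le _ _) (norm_nonneg _) zero_le_one)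
  have h2 : ‖(K.starProjection - L.starProjection) ∘L A ∘L L.starProjection‖ ≤
      ‖K.starProjection - L.starProjection‖ * (‖A‖ * 1) :=
    (ContinuousLinearMap.opNorm_comp_le _ _).trans (mul_le_mul_of_nonneg_left
      ((ContinuousLinearMap.opNorm_comp_le _ _).trans
        (mul_le_mul_of_nonneg_left L.starProjection_norm_le (norm_nonneg _))) (norm_nonneg _))
  linarith [norm_sub_le ((ContinuousLinearMap.id ℝ E - K.starProjection) ∘L A ∘L
      (K.starProjection - L.starProjection))
        ((K.starProjection - L.starProjection) ∘L A ∘L L.starProjection)]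

/-- Uniqueness for the linear equation. The semigroup law, the commutation rules and the explicit
solutions below all follow by exhibiting a solution. -/
theorem eq_flow_of_hasDerivAt (A : E →L[ℝ] E) {y : ℝ → E} (hy : ∀ t, HasDerivAt y (A (y t)) t)
    (t : ℝ) : y t = flow A t (y 0) := by
  have := ODE_solution_unique_univ (v := fun _ => A) (s := fun _ => univ) (K := ‖A‖₊) (t₀ := 0)
    (f := y) (g := fun t => flow A t (y 0)) (fun t => A.lipschitz.lipschitzOnWith)
    (fun t => ⟨hy t, trivial⟩) (fun t => ⟨(flow_solves A (y 0)).2 t, trivial⟩)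
    (flow_solves A (y 0)).1.symm
  exact congrFun this t

theorem flow_add_apply (A : E →L[ℝ] E) (s t : ℝ) (u : E) :
    flow A (s + t) u = flow A s (flow A t u) := by
  have := eq_flow_of_hasDerivAt A (y := fun r => flow A (r + t) u)
    (fun r => ((flow_solves A u).2 (r + t)).comp_add_const r t) s
  simpa using this

theorem flow_neg_flow (A : E →L[ℝ] E) (t : ℝ) (u : E) : flow A (-t) (flow A t u) = u := by
  rw [← flow_add_apply, neg_add_cancel, (flow_solves A u).1]

theorem flow_commute (A : E →L[ℝ] E) (t : ℝ) (u : E) : A (flow A t u) = flow A t (A u) := by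
  have := eq_flow_of_hasDerivAt A (y := fun r => A (flow A r u))
    (fun r => A.hasFDerivAt.comp_hasDerivAt r ((flow_solves A u).2 r)) t
  simpa [(flow_solves A u).1] using this

theorem image_add (A : E →L[ℝ] E) (s t : ℝ) (V : Submodule ℝ E) :
    image A (s + t) V = (image A t V).map (flow A s).toLinearMap := by
  rw [image, image, ← Submodule.map_comp]
  congr 1
  ext u
  exact flow_add_apply A s t u

theorem continuous_flow (A : E →L[ℝ] E) : Continuous (flow A) := by
  have : CompleteSpace E := FiniteDimensional.complete ℝ E
  exact continuous_iff_continuousAt.2 fun t =>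
    (hasDerivAt_exp_smul_const' (𝕂 := ℝ) A t).continuousAt

theorem flow_zero (A : E →L[ℝ] E) : flow A 0 = ContinuousLinearMap.id ℝ E := by
  ext u; exact (flow_solves A u).1

theorem continuous_angularSpeed (A : E →L[ℝ] E) (V : Submodule ℝ E) :
    Continuous (angularSpeed A V) := by
  refine continuous_iff_continuousAt.2 fun t => ?_
  rw [ContinuousAt, tendsto_iff_norm_sub_tendsto_zero]
  have h : Tendsto (fun s => 2 * ‖A‖ * (4 * ‖flow A (s - t) - ContinuousLinearMap.id ℝ E‖)) (𝓝 t)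
      (𝓝 0) := by
    have c : Continuous fun s => 2 * ‖A‖ * (4 * ‖flow A (s - t) - ContinuousLinearMap.id ℝ E‖) := by
      have := continuous_flow A
      fun_prop
    have := c.tendsto t
    simpa [flow_zero] using this
  refine squeeze_zero (fun _ => norm_nonneg _) (fun s => ?_) h
  rw [Real.norm_eq_abs]
  refine (abs_norm_comp_sub_le A _ _).trans (mul_le_mul_of_nonneg_left ?_ (by positivity))
  have e : image A s V = (image A t V).map (flow A (s - t)).toLinearMap := by
    rw [← image_add, sub_add_cancel]
  exact norm_starProjection_map_sub_le e

theorem angularSpeed_eq_zero_of_invariant (A : E →L[ℝ] E) {V : Submodule ℝ E}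
    (h : ∀ v ∈ V, A v ∈ V) (t : ℝ) : angularSpeed A V t = 0 := by
  rw [angularSpeed, norm_eq_zero]
  ext x
  have hx : A ((image A t V).starProjection x) ∈ image A t V := by
    obtain ⟨v, hv, e⟩ := (image A t V).starProjection_apply_mem x
    rw [← e]
    exact ⟨A v, h v hv, (flow_commute A t v).symm⟩
  simp only [ContinuousLinearMap.comp_apply, sub_apply,
    ContinuousLinearMap.id_apply, zero_apply]
  rw [Submodule.starProjection_eq_self_iff.2 hx, sub_self]

/-- With `Φ = flow A t`, the image of `S V` is the image of `Φ V` under `Φ S Φ⁻¹`, so the conjugate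
of `S - 1` measures the distance of the two planes. The constant is `8 = 2 · 4` from the two
preceding estimates. -/
theorem abs_angularSpeed_map_sub_le (A S : E →L[ℝ] E) (V : Submodule ℝ E) (t : ℝ) :
    |angularSpeed A (V.map S.toLinearMap) t - angularSpeed A V t| ≤
      8 * ‖A‖ * ‖flow A t ∘L (S - ContinuousLinearMap.id ℝ E) ∘L flow A (-t)‖ := by
  set N := flow A t ∘L (S - ContinuousLinearMap.id ℝ E) ∘L flow A (-t) with hN
  have e : image A t (V.map S.toLinearMap) =
      (image A t V).map (N + ContinuousLinearMap.id ℝ E).toLinearMap := by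
    rw [image, image, ← Submodule.map_comp, ← Submodule.map_comp]
    congr 1
    ext u
    simp [hN, flow_neg_flow]
  have h := abs_norm_comp_sub_le A (image A t (V.map S.toLinearMap)) (image A t V)
  have h2 := norm_starProjection_map_sub_le e
  rw [add_sub_cancel_right] at h2
  refine h.trans ?_
  calc _ ≤ 2 * ‖A‖ * (4 * ‖N‖) := by gcongr
    _ = _ := by ring

theorem tendsto_averageSpeed_of_exponential (A : E →L[ℝ] E) {V W : Submodule ℝ E} {K l : ℝ}
    (hK : ∀ t, |angularSpeed A V t - angularSpeed A W t| ≤ K * Real.exp (-t))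
    (hW : Tendsto (averageSpeed A W) atTop (𝓝 l)) : Tendsto (averageSpeed A V) atTop (𝓝 l) := by
  have hd : Tendsto (fun T => averageSpeed A V T - averageSpeed A W T) atTop (𝓝 0) := by
    have hlim : Tendsto (fun T : ℝ => K * T⁻¹) atTop (𝓝 0) := by
      simpa using tendsto_inv_atTop_zero.const_mul K
    refine squeeze_zero_norm' ?_ hlim
    filter_upwards [eventually_gt_atTop 0] with T hT
    have cV := (continuous_angularSpeed A V).intervalIntegrable (μ := volume) 0 T
    have cW := (continuous_angularSpeed A W).intervalIntegrable (μ := volume) 0 T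
    rw [averageSpeed, averageSpeed, ← mul_sub, ← intervalIntegral.integral_sub cV cW, norm_mul,
      one_div, Real.norm_of_nonneg (inv_nonneg.2 hT.le), mul_comm]
    refine mul_le_mul_of_nonneg_right ?_ (inv_nonneg.2 hT.le)
    refine (intervalIntegral.norm_integral_le_of_norm_le hT.le
      (Eventually.of_forall fun t _ => hK t)
      (Continuous.intervalIntegrable (by fun_prop) _ _)).trans ?_
    have hK0 : 0 ≤ K := by
      have := (abs_nonneg _).trans (hK 0)
      simpa using this
    rw [intervalIntegral.integral_const_mul, intervalIntegral.integral_comp_neg]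
    rw [integral_exp, neg_zero, Real.exp_zero]
    nlinarith [Real.exp_pos (-T)]
  have := hd.add hW
  simpa using this

/-- A subspace `V` is a graph over the sum of its intersection with `ker p` and its image under the
projection `p`. -/
theorem exists_map_eq (p : E →L[ℝ] E) (hp : ∀ x, p (p x) = p x) (V : Submodule ℝ E) :
    ∃ N : E →L[ℝ] E, V = ((V ⊓ LinearMap.ker p.toLinearMap) ⊔ V.map p.toLinearMap).map
      (ContinuousLinearMap.id ℝ E + (ContinuousLinearMap.id ℝ E - p) ∘L N ∘L p).toLinearMap := by
  let f : V →ₗ[ℝ] V.map p.toLinearMap := p.toLinearMap.submoduleMap V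
  -- A section `g` of `p : V → p V` describes `V` over `p V`. For `y ∈ p V` one has `y + (1 - p) (g
  -- y) = g y` because `p (g y) = y`, so it suffices that `N` extends `g`.
  obtain ⟨g, hg⟩ := f.exists_rightInverse_of_surjective
    (LinearMap.range_eq_top.2 (p.toLinearMap.submoduleMap_surjective V))
  obtain ⟨n, hn⟩ := LinearMap.exists_extend (V.subtype ∘ₗ g)
  refine ⟨LinearMap.toContinuousLinearMap n, ?_⟩
  have hn' : ∀ y : V.map p.toLinearMap, n y = g y := fun y => LinearMap.congr_fun hn y
  have hg' : ∀ y : V.map p.toLinearMap, p (g y) = y := fun y =>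
    congrArg Subtype.val (LinearMap.congr_fun hg y)
  have hS : ∀ y : V.map p.toLinearMap, (ContinuousLinearMap.id ℝ E +
      (ContinuousLinearMap.id ℝ E - p) ∘L LinearMap.toContinuousLinearMap n ∘L p) y = g y := by
    intro y
    have hy : p y = y := by
      obtain ⟨v, _, e⟩ := y.2
      rw [← e]; exact hp v
    simp [hy, hn', hg']
  have hS' : ∀ v, p v = 0 → (ContinuousLinearMap.id ℝ E +
      (ContinuousLinearMap.id ℝ E - p) ∘L LinearMap.toContinuousLinearMap n ∘L p) v = v := by
    intro v hv
    simp [hv]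
  apply le_antisymm
  · intro v hv
    let y : V.map p.toLinearMap := ⟨p v, Submodule.mem_map_of_mem hv⟩
    have hk : p (v - g y) = 0 := by rw [map_sub, hg', sub_self]
    refine ⟨(v - g y) + y, Submodule.add_mem_sup ⟨V.sub_mem hv (g y).2, hk⟩ y.2, ?_⟩
    rw [ContinuousLinearMap.coe_coe, map_add, hS, hS' _ hk, sub_add_cancel]
  · rw [Submodule.map_le_iff_le_comap, sup_le_iff]
    constructor
    · intro v hv
      rw [Submodule.mem_comap, ContinuousLinearMap.coe_coe, hS' v hv.2]
      exact hv.1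
    · intro y hy
      rw [Submodule.mem_comap, ContinuousLinearMap.coe_coe, hS ⟨y, hy⟩]
      exact (g _).2

theorem finrank_inf_ker_add_finrank_map (p : E →L[ℝ] E) (V : Submodule ℝ E) :
    Module.finrank ℝ ↥(V ⊓ LinearMap.ker p.toLinearMap) + Module.finrank ℝ (V.map p.toLinearMap) =
      Module.finrank ℝ V := by
  have h := LinearMap.finrank_range_add_finrank_ker (p.toLinearMap.domRestrict V)
  rw [LinearMap.range_domRestrict, LinearMap.ker_domRestrict] at h
  have e := LinearEquiv.finrank_eq (Submodule.comapSubtypeEquivOfLe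
    (inf_le_left : V ⊓ LinearMap.ker p.toLinearMap ≤ V))
  rw [Submodule.comap_inf, Submodule.comap_subtype_self, top_inf_eq] at e
  rw [← h, ← e, add_comm]

end Euclidean

/-! ### The flow of the model system and the decay of the slow component -/

section Spiral

variable {E : Type*} [NormedAddCommGroup E] [InnerProductSpace ℝ E] [FiniteDimensional ℝ E]

/-- The flow on a vector generating a plane on which `A - σ` is a rotation by `ω`. -/
theorem flow_apply_of_spiral (A : E →L[ℝ] E) {σ ω : ℝ} (hω : ω ≠ 0) {v : E}
    (h : A (A v - σ • v) = σ • (A v - σ • v) - ω ^ 2 • v) (t : ℝ) :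
    flow A t v = Real.exp (σ * t) •
      (Real.cos (ω * t) • v + (Real.sin (ω * t) / ω) • (A v - σ • v)) := by
  set w := A v - σ • v with hw
  have hAv : A v = w + σ • v := by rw [hw]; abel
  have hd : ∀ t, HasDerivAt (fun t => Real.exp (σ * t) •
      (Real.cos (ω * t) • v + (Real.sin (ω * t) / ω) • w))
      (A (Real.exp (σ * t) • (Real.cos (ω * t) • v + (Real.sin (ω * t) / ω) • w))) t := by
    intro t
    have d0 : ∀ c : ℝ, HasDerivAt (fun t : ℝ => c * t) c t := fun c => by
      simpa using (hasDerivAt_id t).const_mul c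
    have d1 := (d0 σ).exp
    have d2 := ((d0 ω).cos).smul_const v
    have d3 := (((d0 ω).sin).div_const ω).smul_const w
    have d := d1.smul (d2.add d3)
    refine d.congr_deriv ?_
    simp only [map_smul, map_add, hAv, h, Pi.add_apply]
    match_scalars <;> field_simp
    ring
  have := eq_flow_of_hasDerivAt A hd t
  simpa using this.symm

end Spiral

/-- The projection of `ℝ⁴` onto the invariant plane of the second block. -/
noncomputable def fastProj : EuclideanSpace ℝ (Fin 4) →L[ℝ] EuclideanSpace ℝ (Fin 4) :=
  Matrix.toEuclideanCLM (n := Fin 4) (𝕜 := ℝ) (Matrix.diagonal ![0, 0, 1, 1])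

theorem fastProj_apply (u : EuclideanSpace ℝ (Fin 4)) : fastProj u = !₂[0, 0, u 2, u 3] := by
  ext i
  fin_cases i <;> simp [fastProj, Matrix.mulVec_diagonal]

theorem modelOp_apply (ω ρ : ℝ × ℝ) (u : EuclideanSpace ℝ (Fin 4)) :
    modelOp ω ρ u = !₂[-(ω.1 / ρ.1) * u 1, ρ.1 * ω.1 * u 0, u 2 - ω.2 / ρ.2 * u 3,
      ρ.2 * ω.2 * u 2 + u 3] := by
  ext i
  fin_cases i <;>
    simp [modelOp, modelMatrix, Matrix.mulVec, dotProduct, Fin.sum_univ_four]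
  ring

theorem fastProj_idem (u : EuclideanSpace ℝ (Fin 4)) : fastProj (fastProj u) = fastProj u := by
  simp [fastProj_apply]

theorem mem_ker_fastProj {u : EuclideanSpace ℝ (Fin 4)} :
    u ∈ LinearMap.ker fastProj.toLinearMap ↔ u 2 = 0 ∧ u 3 = 0 := by
  rw [LinearMap.mem_ker, ContinuousLinearMap.coe_coe, fastProj_apply]
  constructor
  · intro h
    exact ⟨by simpa using congrArg (fun x => x 2) h, by simpa using congrArg (fun x => x 3) h⟩
  · rintro ⟨h2, h3⟩
    ext i; fin_cases i <;> simp [h2, h3]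

theorem mem_range_fastProj {u : EuclideanSpace ℝ (Fin 4)} :
    u ∈ LinearMap.range fastProj.toLinearMap ↔ u 0 = 0 ∧ u 1 = 0 := by
  constructor
  · rintro ⟨v, rfl⟩
    simp [fastProj_apply]
  · rintro ⟨h0, h1⟩
    refine ⟨u, ?_⟩
    rw [ContinuousLinearMap.coe_coe, fastProj_apply]
    ext i; fin_cases i <;> simp [h0, h1]

section

variable {ω ρ : ℝ × ℝ}

theorem flow_apply_slow (h : (ω, ρ) ∈ parameters) {v : EuclideanSpace ℝ (Fin 4)}
    (h2 : v 2 = 0) (h3 : v 3 = 0) (t : ℝ) : flow (modelOp ω ρ) t v =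
      Real.cos (ω.1 * t) • v + (Real.sin (ω.1 * t) / ω.1) • modelOp ω ρ v := by
  have hρ : ρ.1 ≠ 0 := h.2.1.1.ne'
  have hω : ω.1 ≠ 0 := (h.1.1 : 0 < ω.1).ne'
  have := flow_apply_of_spiral (modelOp ω ρ) (σ := 0) hω (v := v) (by
    ext i
    fin_cases i <;> simp [modelOp_apply, h2, h3] <;> field_simp) t
  simpa using this

theorem flow_apply_fast (h : (ω, ρ) ∈ parameters) {v : EuclideanSpace ℝ (Fin 4)}
    (h0 : v 0 = 0) (h1 : v 1 = 0) (t : ℝ) : flow (modelOp ω ρ) t v =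
      Real.exp t • (Real.cos (ω.2 * t) • v + (Real.sin (ω.2 * t) / ω.2) • (modelOp ω ρ v - v)) := by
  have hρ : ρ.2 ≠ 0 := h.2.2.1.ne'
  have hω : ω.2 ≠ 0 := (h.1.2 : 0 < ω.2).ne'
  have := flow_apply_of_spiral (modelOp ω ρ) (σ := 1) hω (v := v) (by
    ext i
    fin_cases i <;> simp [modelOp_apply, h0, h1] <;> field_simp <;> ring) t
  simpa using this

theorem fastProj_flow (t : ℝ) (u : EuclideanSpace ℝ (Fin 4)) :
    fastProj (flow (modelOp ω ρ) t u) = flow (modelOp ω ρ) t (fastProj u) := by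
  have := eq_flow_of_hasDerivAt (modelOp ω ρ) (y := fun r => fastProj (flow (modelOp ω ρ) r u))
    (fun r => by
      have e := fastProj.hasFDerivAt.comp_hasDerivAt r ((flow_solves (modelOp ω ρ) u).2 r)
      refine e.congr_deriv ?_
      ext i
      fin_cases i <;> simp [modelOp_apply, fastProj_apply]) t
  simpa [(flow_solves (modelOp ω ρ) u).1] using this

/-- The operator `(1 - p) N p` maps the second block to the first. The backward flow on the second
block carries the factor `e^{-t}`, and the forward flow on the first block is bounded. -/
theorem norm_flow_conj_le (h : (ω, ρ) ∈ parameters)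
    (N : EuclideanSpace ℝ (Fin 4) →L[ℝ] EuclideanSpace ℝ (Fin 4)) :
    ∃ C, ∀ t, ‖flow (modelOp ω ρ) t ∘L ((ContinuousLinearMap.id ℝ _ - fastProj) ∘L N ∘L fastProj) ∘L
      flow (modelOp ω ρ) (-t)‖ ≤ C * Real.exp (-t) := by
  set A := modelOp ω ρ with hA
  set s := ContinuousLinearMap.id ℝ (EuclideanSpace ℝ (Fin 4)) - fastProj with hs
  have hω1 : 0 < ω.1 := h.1.1
  have hω2 : 0 < ω.2 := h.1.2
  have hsin : ∀ x w : ℝ, 0 < w → |Real.sin x / w| ≤ 1 / w := fun x w hw => by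
    rw [abs_div, abs_of_pos hw]
    exact div_le_div_of_nonneg_right (Real.abs_sin_le_one x) hw.le
  have b1 : ∀ t u, ‖flow A t (s u)‖ ≤ (‖s‖ + 1 / ω.1 * (‖A‖ * ‖s‖)) * ‖u‖ := by
    intro t u
    have hsu : ∀ j : Fin 4, (s u) j = u j - (fastProj u) j := fun j => by simp [hs]
    rw [flow_apply_slow h (by simp [hsu, fastProj_apply]) (by simp [hsu, fastProj_apply])]
    refine (norm_add_le _ _).trans ?_
    rw [norm_smul, norm_smul, Real.norm_eq_abs, Real.norm_eq_abs]
    have c1 := s.le_opNorm u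
    have c2 := (A.le_opNorm (s u)).trans (mul_le_mul_of_nonneg_left c1 (norm_nonneg A))
    calc _ ≤ 1 * (‖s‖ * ‖u‖) + 1 / ω.1 * (‖A‖ * (‖s‖ * ‖u‖)) :=
          add_le_add (mul_le_mul (Real.abs_cos_le_one _) c1 (norm_nonneg _) zero_le_one)
            (mul_le_mul (hsin _ _ hω1) c2 (norm_nonneg _) (by positivity))
      _ = _ := by ring
  have b2 : ∀ t u, ‖fastProj (flow A (-t) u)‖ ≤
      Real.exp (-t) * ((‖fastProj‖ + 1 / ω.2 * ((‖A‖ + 1) * ‖fastProj‖)) * ‖u‖) := by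
    intro t u
    rw [hA, fastProj_flow, flow_apply_fast h (by simp [fastProj_apply]) (by simp [fastProj_apply]),
      ← hA, norm_smul, Real.norm_of_nonneg (Real.exp_pos _).le]
    refine mul_le_mul_of_nonneg_left ((norm_add_le _ _).trans ?_) (Real.exp_pos _).le
    rw [norm_smul, norm_smul, Real.norm_eq_abs, Real.norm_eq_abs]
    have c1 := fastProj.le_opNorm u
    have c2 : ‖A (fastProj u) - fastProj u‖ ≤ (‖A‖ + 1) * (‖fastProj‖ * ‖u‖) := by
      calc _ ≤ ‖A (fastProj u)‖ + ‖fastProj u‖ := norm_sub_le _ _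
        _ ≤ ‖A‖ * ‖fastProj u‖ + ‖fastProj u‖ := by gcongr; exact A.le_opNorm _
        _ = (‖A‖ + 1) * ‖fastProj u‖ := by ring
        _ ≤ _ := by gcongr
    calc _ ≤ 1 * (‖fastProj‖ * ‖u‖) + 1 / ω.2 * ((‖A‖ + 1) * (‖fastProj‖ * ‖u‖)) :=
          add_le_add (mul_le_mul (Real.abs_cos_le_one _) c1 (norm_nonneg _) zero_le_one)
            (mul_le_mul (hsin _ _ hω2) c2 (norm_nonneg _) (by positivity))
      _ = _ := by ring
  set C1 := ‖s‖ + 1 / ω.1 * (‖A‖ * ‖s‖)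
  set C2 := ‖fastProj‖ + 1 / ω.2 * ((‖A‖ + 1) * ‖fastProj‖)
  have hC1 : 0 ≤ C1 := by positivity
  have hC2 : 0 ≤ C2 := by positivity
  refine ⟨C1 * ‖N‖ * C2, fun t => ContinuousLinearMap.opNorm_le_bound _
    (by positivity) fun u => ?_⟩
  calc _ ≤ C1 * ‖N (fastProj (flow A (-t) u))‖ := b1 t _
    _ ≤ C1 * (‖N‖ * (Real.exp (-t) * (C2 * ‖u‖))) := by
      gcongr
      exact (N.le_opNorm _).trans (mul_le_mul_of_nonneg_left (b2 t u) (norm_nonneg N))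
    _ = _ := by ring

/-! ### Planes spanned by one ellipse vector from each block -/

variable (ρ) in
/-- The point of the ellipse with half axes `1, ρ₁` in the plane of the first block. -/
noncomputable def slowVec (a : ℝ) : EuclideanSpace ℝ (Fin 4) :=
  !₂[Real.cos a, ρ.1 * Real.sin a, 0, 0]

variable (ρ) in
/-- The point of the ellipse with half axes `1, ρ₂` in the plane of the second block. -/
noncomputable def fastVec (b : ℝ) : EuclideanSpace ℝ (Fin 4) :=
  !₂[0, 0, Real.cos b, ρ.2 * Real.sin b]

variable (ρ) in
/-- The plane spanned by `slowVec` and `fastVec`. -/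
noncomputable def ellipsePlane (a b : ℝ) : Submodule ℝ (EuclideanSpace ℝ (Fin 4)) :=
  Submodule.span ℝ {slowVec ρ a} ⊔ Submodule.span ℝ {fastVec ρ b}

theorem flow_slowVec (h : (ω, ρ) ∈ parameters) (a t : ℝ) :
    flow (modelOp ω ρ) t (slowVec ρ a) = slowVec ρ (a + ω.1 * t) := by
  have hρ : ρ.1 ≠ 0 := h.2.1.1.ne'
  have hω : ω.1 ≠ 0 := (h.1.1 : 0 < ω.1).ne'
  rw [flow_apply_slow h (by simp [slowVec]) (by simp [slowVec])]
  ext i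
  fin_cases i <;> simp [modelOp_apply, slowVec, Real.cos_add, Real.sin_add] <;> field_simp <;> ring

theorem flow_fastVec (h : (ω, ρ) ∈ parameters) (b t : ℝ) :
    flow (modelOp ω ρ) t (fastVec ρ b) = Real.exp t • fastVec ρ (b + ω.2 * t) := by
  have hρ : ρ.2 ≠ 0 := h.2.2.1.ne'
  have hω : ω.2 ≠ 0 := (h.1.2 : 0 < ω.2).ne'
  rw [flow_apply_fast h (by simp [fastVec]) (by simp [fastVec])]
  congr 1
  ext i
  fin_cases i <;> simp [modelOp_apply, fastVec, Real.cos_add, Real.sin_add] <;> field_simp <;> ring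

theorem image_ellipsePlane (h : (ω, ρ) ∈ parameters) (a b t : ℝ) :
    image (modelOp ω ρ) t (ellipsePlane ρ a b) = ellipsePlane ρ (a + ω.1 * t) (b + ω.2 * t) := by
  rw [image, ellipsePlane, Submodule.map_sup, Submodule.map_span, Submodule.map_span,
    image_singleton, image_singleton, ContinuousLinearMap.coe_coe, flow_slowVec h, flow_fastVec h,
    Submodule.span_singleton_smul_eq (IsUnit.mk0 _ (Real.exp_pos t).ne'), ellipsePlane]

/-- The two spanning vectors lie in orthogonal coordinate planes, so the projection is the sum of
the projections onto two lines; the denominators are the squared lengths. -/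
theorem starProjection_ellipsePlane (h : (ω, ρ) ∈ parameters) (a b : ℝ)
    (u : EuclideanSpace ℝ (Fin 4)) : (ellipsePlane ρ a b).starProjection u =
      ((u 0 * Real.cos a + u 1 * (ρ.1 * Real.sin a)) /
        (Real.cos a ^ 2 + ρ.1 ^ 2 * Real.sin a ^ 2)) • slowVec ρ a +
      ((u 2 * Real.cos b + u 3 * (ρ.2 * Real.sin b)) /
        (Real.cos b ^ 2 + ρ.2 ^ 2 * Real.sin b ^ 2)) • fastVec ρ b := by
  have d1 := (ellipse_denom_pos h.2.1 a).ne'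
  have d2 := (ellipse_denom_pos h.2.2 b).ne'
  simp only at d1 d2
  refine Submodule.eq_starProjection_of_mem_of_inner_eq_zero ?_ ?_
  · exact Submodule.add_mem_sup (Submodule.smul_mem _ _ (Submodule.mem_span_singleton_self _))
      (Submodule.smul_mem _ _ (Submodule.mem_span_singleton_self _))
  · intro w hw
    obtain ⟨x, hx, y, hy, rfl⟩ := Submodule.mem_sup.1 hw
    obtain ⟨r, rfl⟩ := Submodule.mem_span_singleton.1 hx
    obtain ⟨s, rfl⟩ := Submodule.mem_span_singleton.1 hy
    simp [PiLp.inner_apply, Fin.sum_univ_four, slowVec, fastVec]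
    field_simp
    ring

/-- In each block, the part of `A v` normal to the ellipse vector `v` is `E` times the quarter turn
of `v`: with `n = (-ρ sin a, cos a)` one finds `⟪A v, n⟫ = ρ ω`, and `‖n‖²` is the denominator of
`E`. -/
theorem angular_rate_ellipsePlane (h : (ω, ρ) ∈ parameters) (a b : ℝ)
    (u : EuclideanSpace ℝ (Fin 4)) :
    ((ContinuousLinearMap.id ℝ _ - (ellipsePlane ρ a b).starProjection) ∘L modelOp ω ρ ∘L
      (ellipsePlane ρ a b).starProjection) u =
      ((u 0 * Real.cos a + u 1 * (ρ.1 * Real.sin a)) /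
        (Real.cos a ^ 2 + ρ.1 ^ 2 * Real.sin a ^ 2) * ellipseSpeed ρ.1 ω.1 a) •
          !₂[-(ρ.1 * Real.sin a), Real.cos a, 0, 0] +
      ((u 2 * Real.cos b + u 3 * (ρ.2 * Real.sin b)) /
        (Real.cos b ^ 2 + ρ.2 ^ 2 * Real.sin b ^ 2) * ellipseSpeed ρ.2 ω.2 b) •
          !₂[0, 0, -(ρ.2 * Real.sin b), Real.cos b] := by
  have d1 := (ellipse_denom_pos h.2.1 a).ne'
  have d2 := (ellipse_denom_pos h.2.2 b).ne'
  have hρ1 : ρ.1 ≠ 0 := h.2.1.1.ne'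
  have hρ2 : ρ.2 ≠ 0 := h.2.2.1.ne'
  simp only at d1 d2
  simp only [ContinuousLinearMap.comp_apply, sub_apply, ContinuousLinearMap.id_apply]
  rw [starProjection_ellipsePlane h a b u]
  set α := (u 0 * Real.cos a + u 1 * (ρ.1 * Real.sin a)) /
    (Real.cos a ^ 2 + ρ.1 ^ 2 * Real.sin a ^ 2)
  set β := (u 2 * Real.cos b + u 3 * (ρ.2 * Real.sin b)) /
    (Real.cos b ^ 2 + ρ.2 ^ 2 * Real.sin b ^ 2)
  rw [starProjection_ellipsePlane h a b]
  have ta := Real.sin_sq_add_cos_sq a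
  have tb := Real.sin_sq_add_cos_sq b
  ext i
  fin_cases i
  · simp [modelOp_apply, slowVec, fastVec, ellipseSpeed]
    field_simp
    linear_combination (-(α * ω.1 * Real.sin a * ρ.1 ^ 2)) * ta
  · simp [modelOp_apply, slowVec, fastVec, ellipseSpeed]
    field_simp
    linear_combination (α * ω.1 * Real.cos a) * ta
  · simp [modelOp_apply, slowVec, fastVec, ellipseSpeed]
    field_simp
    linear_combination (-(β * ω.2 * Real.sin b * ρ.2 ^ 2)) * tb
  · simp [modelOp_apply, slowVec, fastVec, ellipseSpeed]
    field_simp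
    linear_combination (β * ω.2 * Real.cos b) * tb

/-- The operator is a sum of two rank-one maps acting in orthogonal planes, of norms `E_1` and
`E_2`, so its norm is the maximum. -/
theorem norm_angular_rate_ellipsePlane (h : (ω, ρ) ∈ parameters) (a b : ℝ)
    {W : Submodule ℝ (EuclideanSpace ℝ (Fin 4))} (hW : W = ellipsePlane ρ a b) :
    ‖(ContinuousLinearMap.id ℝ _ - W.starProjection) ∘L modelOp ω ρ ∘L W.starProjection‖ =
      maxSpeed ω ρ a b := by
  subst hW
  have d1 := ellipse_denom_pos h.2.1 a
  have d2 := ellipse_denom_pos h.2.2 b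
  have k1 := ellipseSpeed_nonneg h.2.1 h.1.1 a
  have k2 := ellipseSpeed_nonneg h.2.2 h.1.2 b
  simp only at d1 d2 k1 k2
  have l1 : ellipseSpeed ρ.1 ω.1 a ≤ maxSpeed ω ρ a b := le_max_left _ _
  have l2 : ellipseSpeed ρ.2 ω.2 b ≤ maxSpeed ω ρ a b := le_max_right _ _
  have hm := maxSpeed_nonneg h a b
  set L := (ContinuousLinearMap.id ℝ _ - (ellipsePlane ρ a b).starProjection) ∘L modelOp ω ρ ∘L
    (ellipsePlane ρ a b).starProjection with hL
  have key := angular_rate_ellipsePlane h a b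
  rw [← hL] at key
  set x := ellipseSpeed ρ.1 ω.1 a
  set y := ellipseSpeed ρ.2 ω.2 b
  apply le_antisymm
  · refine L.opNorm_le_bound hm fun u => ?_
    refine le_of_sq_le_sq ?_ (by positivity)
    rw [key, mul_pow, EuclideanSpace.real_norm_sq_eq, EuclideanSpace.real_norm_sq_eq]
    simp only [Fin.sum_univ_four]
    simp
    set D1 := Real.cos a ^ 2 + ρ.1 ^ 2 * Real.sin a ^ 2 with hD1
    set D2 := Real.cos b ^ 2 + ρ.2 ^ 2 * Real.sin b ^ 2 with hD2
    set P := u 0 * Real.cos a + u 1 * (ρ.1 * Real.sin a) with hP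
    set Q := u 2 * Real.cos b + u 3 * (ρ.2 * Real.sin b) with hQ
    -- Cauchy–Schwarz; the square supplied is the defect in Lagrange's identity.
    have c1 : P ^ 2 / D1 ≤ u 0 ^ 2 + u 1 ^ 2 := by
      rw [div_le_iff₀ d1, hP, hD1]
      nlinarith [sq_nonneg (u 0 * (ρ.1 * Real.sin a) - u 1 * Real.cos a)]
    have c2 : Q ^ 2 / D2 ≤ u 2 ^ 2 + u 3 ^ 2 := by
      rw [div_le_iff₀ d2, hQ, hD2]
      nlinarith [sq_nonneg (u 2 * (ρ.2 * Real.sin b) - u 3 * Real.cos b)]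
    have q1 : x ^ 2 ≤ maxSpeed ω ρ a b ^ 2 := pow_le_pow_left₀ k1 l1 2
    have q2 : y ^ 2 ≤ maxSpeed ω ρ a b ^ 2 := pow_le_pow_left₀ k2 l2 2
    calc _ = P ^ 2 / D1 * x ^ 2 * ((Real.cos a ^ 2 + ρ.1 ^ 2 * Real.sin a ^ 2) / D1) +
          Q ^ 2 / D2 * y ^ 2 * ((Real.cos b ^ 2 + ρ.2 ^ 2 * Real.sin b ^ 2) / D2) := by ring
      _ = P ^ 2 / D1 * x ^ 2 + Q ^ 2 / D2 * y ^ 2 := by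
        rw [← hD1, ← hD2, div_self d1.ne', div_self d2.ne', mul_one, mul_one]
      _ ≤ (u 0 ^ 2 + u 1 ^ 2) * maxSpeed ω ρ a b ^ 2 +
          (u 2 ^ 2 + u 3 ^ 2) * maxSpeed ω ρ a b ^ 2 := by gcongr
      _ = _ := by ring
  -- Each speed is attained on the corresponding ellipse vector.
  · refine max_le ?_ ?_
    · have hn : ‖slowVec ρ a‖ ^ 2 = Real.cos a ^ 2 + ρ.1 ^ 2 * Real.sin a ^ 2 := by
        rw [EuclideanSpace.real_norm_sq_eq]
        simp [Fin.sum_univ_four, slowVec, mul_pow]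
      have hpos : 0 < ‖slowVec ρ a‖ := by
        refine (norm_nonneg _).lt_of_ne fun h0 => ?_
        rw [← h0] at hn; linarith
      have e : ‖L (slowVec ρ a)‖ = x * ‖slowVec ρ a‖ := by
        rw [← sq_eq_sq₀ (norm_nonneg _) (by positivity), mul_pow, hn, key,
          EuclideanSpace.real_norm_sq_eq]
        simp [Fin.sum_univ_four, slowVec]
        field_simp
        ring
      exact le_of_mul_le_mul_right (e ▸ L.le_opNorm _) hpos
    · have hn : ‖fastVec ρ b‖ ^ 2 = Real.cos b ^ 2 + ρ.2 ^ 2 * Real.sin b ^ 2 := by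
        rw [EuclideanSpace.real_norm_sq_eq]
        simp [Fin.sum_univ_four, fastVec, mul_pow]
      have hpos : 0 < ‖fastVec ρ b‖ := by
        refine (norm_nonneg _).lt_of_ne fun h0 => ?_
        rw [← h0] at hn; linarith
      have e : ‖L (fastVec ρ b)‖ = y * ‖fastVec ρ b‖ := by
        rw [← sq_eq_sq₀ (norm_nonneg _) (by positivity), mul_pow, hn, key,
          EuclideanSpace.real_norm_sq_eq]
        simp [Fin.sum_univ_four, fastVec]
        field_simp
        ring
      exact le_of_mul_le_mul_right (e ▸ L.le_opNorm _) hpos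

theorem averageSpeed_ellipsePlane (h : (ω, ρ) ∈ parameters) (a b : ℝ) :
    averageSpeed (modelOp ω ρ) (ellipsePlane ρ a b) = orbitAverage ω ρ a b := by
  funext T
  rw [averageSpeed, orbitAverage]
  congr 1
  exact intervalIntegral.integral_congr fun t _ =>
    norm_angular_rate_ellipsePlane h _ _ (image_ellipsePlane h a b t)

/-! ### Reduction of an arbitrary plane and identification of the angular value -/

theorem exists_polar {r : ℝ} (hr : r ≠ 0) (x y : ℝ) :
    ∃ s θ : ℝ, x = s * Real.cos θ ∧ y = s * (r * Real.sin θ) := by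
  let z : ℂ := ⟨x, y / r⟩
  refine ⟨‖z‖, z.arg, (Complex.norm_mul_cos_arg z).symm, ?_⟩
  have := Complex.norm_mul_sin_arg z
  rw [mul_left_comm, this]
  simp only [z]
  field_simp

theorem span_singleton_eq_slowVec (h : (ω, ρ) ∈ parameters) {v : EuclideanSpace ℝ (Fin 4)}
    (hv : v ≠ 0) (h2 : v 2 = 0) (h3 : v 3 = 0) :
    ∃ a, Submodule.span ℝ {v} = Submodule.span ℝ {slowVec ρ a} := by
  obtain ⟨s, a, hx, hy⟩ := exists_polar (h.2.1.1.ne' : ρ.1 ≠ 0) (v 0) (v 1)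
  have e : v = s • slowVec ρ a := by
    ext i; fin_cases i <;> simp [slowVec, h2, h3, ← hx, ← hy]
  have hs : s ≠ 0 := by rintro rfl; exact hv (by rw [e, zero_smul])
  exact ⟨a, by rw [e, Submodule.span_singleton_smul_eq (IsUnit.mk0 _ hs)]⟩

theorem span_singleton_eq_fastVec (h : (ω, ρ) ∈ parameters) {v : EuclideanSpace ℝ (Fin 4)}
    (hv : v ≠ 0) (h0 : v 0 = 0) (h1 : v 1 = 0) :
    ∃ b, Submodule.span ℝ {v} = Submodule.span ℝ {fastVec ρ b} := by
  obtain ⟨s, b, hx, hy⟩ := exists_polar (h.2.2.1.ne' : ρ.2 ≠ 0) (v 2) (v 3)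
  have e : v = s • fastVec ρ b := by
    ext i; fin_cases i <;> simp [fastVec, h0, h1, ← hx, ← hy]
  have hs : s ≠ 0 := by rintro rfl; exact hv (by rw [e, zero_smul])
  exact ⟨b, by rw [e, Submodule.span_singleton_smul_eq (IsUnit.mk0 _ hs)]⟩

theorem finrank_ellipsePlane (h : (ω, ρ) ∈ parameters) (a b : ℝ) :
    Module.finrank ℝ (ellipsePlane ρ a b) = 2 := by
  have d1 := ellipse_denom_pos h.2.1 a
  have d2 := ellipse_denom_pos h.2.2 b
  simp only at d1 d2
  have hli : LinearIndependent ℝ ![slowVec ρ a, fastVec ρ b] := by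
    rw [LinearIndependent.pair_iff]
    intro s t e
    have e0 := congrArg (fun x => x 0) e
    have e1 := congrArg (fun x => x 1) e
    have e2 := congrArg (fun x => x 2) e
    have e3 := congrArg (fun x => x 3) e
    simp [slowVec, fastVec] at e0 e1 e2 e3
    constructor
    · by_contra hs
      simp only [hs, false_or] at e0 e1
      have : Real.cos a ^ 2 + ρ.1 ^ 2 * Real.sin a ^ 2 = 0 := by
        rw [← mul_pow, e0, mul_eq_zero.2 e1]; norm_num
      linarith
    · by_contra hs
      simp only [hs, false_or] at e2 e3
      have : Real.cos b ^ 2 + ρ.2 ^ 2 * Real.sin b ^ 2 = 0 := by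
        rw [← mul_pow, e2, mul_eq_zero.2 e3]; norm_num
      linarith
  have := finrank_span_eq_card hli
  rw [Matrix.range_cons, Matrix.range_cons, Matrix.range_empty, union_empty,
    Submodule.span_union] at this
  rw [ellipsePlane]
  exact this.trans (by simp)

theorem finrank_ker_and_range_fastProj_le_two :
    Module.finrank ℝ (LinearMap.ker fastProj.toLinearMap) ≤ 2 ∧
      Module.finrank ℝ (LinearMap.range fastProj.toLinearMap) ≤ 2 := by
  constructor
  · have : LinearMap.ker fastProj.toLinearMap ≤
        Submodule.span ℝ {EuclideanSpace.single 0 1, EuclideanSpace.single 1 1} := by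
      intro u hu
      rw [mem_ker_fastProj] at hu
      rw [Submodule.mem_span_pair]
      refine ⟨u 0, u 1, ?_⟩
      ext i; fin_cases i <;> simp [hu.1, hu.2]
    exact (Submodule.finrank_mono this).trans (by
      have := finrank_span_finset_le_card (R := ℝ)
        ({EuclideanSpace.single 0 1, EuclideanSpace.single 1 1} : Finset (EuclideanSpace ℝ (Fin 4)))
      simp only [Finset.coe_insert, Finset.coe_singleton] at this
      exact this.trans Finset.card_le_two)
  · have : LinearMap.range fastProj.toLinearMap ≤
        Submodule.span ℝ {EuclideanSpace.single 2 1, EuclideanSpace.single 3 1} := by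
      intro u hu
      rw [mem_range_fastProj] at hu
      rw [Submodule.mem_span_pair]
      refine ⟨u 2, u 3, ?_⟩
      ext i; fin_cases i <;> simp [hu.1, hu.2]
    exact (Submodule.finrank_mono this).trans (by
      have := finrank_span_finset_le_card (R := ℝ)
        ({EuclideanSpace.single 2 1, EuclideanSpace.single 3 1} : Finset (EuclideanSpace ℝ (Fin 4)))
      simp only [Finset.coe_insert, Finset.coe_singleton] at this
      exact this.trans Finset.card_le_two)

theorem tendsto_averageSpeed_of_invariant {V : Submodule ℝ (EuclideanSpace ℝ (Fin 4))}
    (hV : ∀ v ∈ V, modelOp ω ρ v ∈ V) : Tendsto (averageSpeed (modelOp ω ρ) V) atTop (𝓝 0) := by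
  have : averageSpeed (modelOp ω ρ) V = fun _ => 0 := by
    funext T
    simp [averageSpeed, angularSpeed_eq_zero_of_invariant _ hV]
  rw [this]
  exact tendsto_const_nhds

/-- The sum of a subspace of the first block and one of the second block, of total dimension two,
is invariant or spanned by two ellipse vectors. -/
theorem invariant_or_eq_ellipsePlane (h : (ω, ρ) ∈ parameters)
    {V₁ V₂ : Submodule ℝ (EuclideanSpace ℝ (Fin 4))}
    (h₁ : V₁ ≤ LinearMap.ker fastProj.toLinearMap) (h₂ : V₂ ≤ LinearMap.range fastProj.toLinearMap)
    (hdim : Module.finrank ℝ V₁ + Module.finrank ℝ V₂ = 2) :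
    (∀ v ∈ V₁ ⊔ V₂, modelOp ω ρ v ∈ V₁ ⊔ V₂) ∨ ∃ a b, V₁ ⊔ V₂ = ellipsePlane ρ a b := by
  obtain ⟨hk, hr⟩ := finrank_ker_and_range_fastProj_le_two
  have cases : Module.finrank ℝ V₁ = 0 ∨ Module.finrank ℝ V₁ = 1 ∨ Module.finrank ℝ V₁ = 2 := by
    omega
  rcases cases with hd | hd | hd
  · left
    have e1 : V₁ = ⊥ := Submodule.finrank_eq_zero.1 hd
    have e2 : V₂ = LinearMap.range fastProj.toLinearMap :=
      Submodule.eq_of_le_of_finrank_le h₂ (by omega)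
    rw [e1, bot_sup_eq, e2]
    intro v hv
    rw [mem_range_fastProj] at hv ⊢
    simp [modelOp_apply, hv.1, hv.2]
  · right
    obtain ⟨v, hv0, hv⟩ := finrank_eq_one_iff'.1 hd
    obtain ⟨w, hw0, hw⟩ := finrank_eq_one_iff'.1 (show Module.finrank ℝ V₂ = 1 by omega)
    have span_eq : ∀ {U : Submodule ℝ (EuclideanSpace ℝ (Fin 4))} {v : U},
        (∀ w : U, ∃ c : ℝ, c • v = w) → U = Submodule.span ℝ {(v : EuclideanSpace ℝ (Fin 4))} := by
      intro U v hv
      apply le_antisymm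
      · intro x hx
        obtain ⟨c, hc⟩ := hv ⟨x, hx⟩
        exact Submodule.mem_span_singleton.2 ⟨c, congrArg Subtype.val hc⟩
      · rw [Submodule.span_singleton_le_iff_mem]; exact v.2
    have kv := mem_ker_fastProj.1 (h₁ v.2)
    have kw := mem_range_fastProj.1 (h₂ w.2)
    obtain ⟨a, ha⟩ := span_singleton_eq_slowVec h (fun e => hv0 (Subtype.ext e)) kv.1 kv.2
    obtain ⟨b, hb⟩ := span_singleton_eq_fastVec h (fun e => hw0 (Subtype.ext e)) kw.1 kw.2
    exact ⟨a, b, by rw [ellipsePlane, ← ha, ← hb, ← span_eq hv, ← span_eq hw]⟩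
  · left
    have e2 : V₂ = ⊥ := Submodule.finrank_eq_zero.1 (by omega)
    have e1 : V₁ = LinearMap.ker fastProj.toLinearMap :=
      Submodule.eq_of_le_of_finrank_le h₁ (by omega)
    rw [e2, sup_bot_eq, e1]
    intro v hv
    rw [mem_ker_fastProj] at hv ⊢
    simp [modelOp_apply, hv.1, hv.2]

theorem exists_tendsto_averageSpeed (h : (ω, ρ) ∈ parameters)
    {V : Submodule ℝ (EuclideanSpace ℝ (Fin 4))} (hV : Module.finrank ℝ V = 2) :
    ∃ l, Tendsto (averageSpeed (modelOp ω ρ) V) atTop (𝓝 l) ∧ l ≤ supMeanSpeed ω ρ := by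
  obtain ⟨N, hN⟩ := exists_map_eq fastProj fastProj_idem V
  set W := (V ⊓ LinearMap.ker fastProj.toLinearMap) ⊔ V.map fastProj.toLinearMap with hW
  obtain ⟨C, hC⟩ := norm_flow_conj_le h N
  have transfer : ∀ l, Tendsto (averageSpeed (modelOp ω ρ) W) atTop (𝓝 l) →
      Tendsto (averageSpeed (modelOp ω ρ) V) atTop (𝓝 l) := by
    intro l
    refine tendsto_averageSpeed_of_exponential (K := 8 * ‖modelOp ω ρ‖ * C) _ fun t => ?_
    have e := abs_angularSpeed_map_sub_le (modelOp ω ρ) (ContinuousLinearMap.id ℝ _ +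
      (ContinuousLinearMap.id ℝ _ - fastProj) ∘L N ∘L fastProj) W t
    rw [← hN, add_sub_cancel_left] at e
    rw [mul_assoc _ C]
    exact e.trans (mul_le_mul_of_nonneg_left (hC t) (by positivity))
  have hdim := finrank_inf_ker_add_finrank_map fastProj V
  rw [hV] at hdim
  rcases invariant_or_eq_ellipsePlane h inf_le_right LinearMap.map_le_range hdim with hi | ⟨a, b, e⟩
  -- Invariant limit planes contribute zero, which does not affect the supremum since mean speeds
  -- are nonnegative.
  · exact ⟨0, transfer 0 (tendsto_averageSpeed_of_invariant hi),
      (meanSpeed_nonneg h 0 0).trans (meanSpeed_le_supMeanSpeed h 0 0)⟩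
  · refine ⟨meanSpeed ω ρ a b, transfer _ ?_, meanSpeed_le_supMeanSpeed h a b⟩
    rw [hW, e, averageSpeed_ellipsePlane h]
    exact tendsto_orbitAverage h a b

/-- The functional `Φ` stands for both the upper and the lower limit, which agree wherever the
averages converge. -/
theorem iSup_eq_supMeanSpeed (h : (ω, ρ) ∈ parameters)
    {Φ : Submodule ℝ (EuclideanSpace ℝ (Fin 4)) → EReal}
    (hΦ : ∀ V l, Tendsto (averageSpeed (modelOp ω ρ) V) atTop (𝓝 l) → Φ V = (l : EReal)) :
    ⨆ V ∈ grassmannian (EuclideanSpace ℝ (Fin 4)) 2, Φ V = (supMeanSpeed ω ρ : EReal) := by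
  apply le_antisymm
  · refine iSup₂_le fun V hV => ?_
    obtain ⟨l, hl, hle⟩ := exists_tendsto_averageSpeed h hV
    rw [hΦ V l hl]
    exact_mod_cast hle
  · have hge : ∀ x : ℝ × ℝ, (meanSpeed ω ρ x.1 x.2 : EReal) ≤
        ⨆ V ∈ grassmannian (EuclideanSpace ℝ (Fin 4)) 2, Φ V := by
      intro x
      rw [← hΦ (ellipsePlane ρ x.1 x.2) _
        (by rw [averageSpeed_ellipsePlane h]; exact tendsto_orbitAverage h x.1 x.2)]
      exact le_iSup₂_of_le _ (finrank_ellipsePlane h x.1 x.2) le_rfl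
    -- Passing to real numbers `z` below the supremum allows the real supremum to be compared with
    -- the one in `EReal`.
    refine EReal.ge_of_forall_gt_iff_ge.1 fun z hz => ?_
    have hz' : z < ⨆ x : ℝ × ℝ, meanSpeed ω ρ x.1 x.2 := by exact_mod_cast hz
    obtain ⟨x, hx⟩ := exists_lt_of_lt_ciSup hz'
    exact (EReal.coe_le_coe_iff.2 hx.le).trans (hge x)

end

end AngularValue

theorem mainTheorem11 :
    ∃ ϑ : (ℝ × ℝ) × (ℝ × ℝ) → ℝ,
      -- `ϑ` is the second outer angular value of the model system
      (∀ ω ρ : ℝ × ℝ, (ω, ρ) ∈ AngularValue.parameters →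
        (∀ V ∈ AngularValue.grassmannian (EuclideanSpace ℝ (Fin 4)) 2, ∃ l : ℝ,
          Tendsto (AngularValue.averageSpeed (AngularValue.modelOp ω ρ) V) atTop (𝓝 l)) ∧
        AngularValue.outerSupLimsup 2 (AngularValue.modelOp ω ρ) = (ϑ (ω, ρ) : EReal) ∧
        AngularValue.outerSupLiminf 2 (AngularValue.modelOp ω ρ) = (ϑ (ω, ρ) : EReal)) ∧
      -- upper semicontinuity
      UpperSemicontinuousOn ϑ AngularValue.parameters ∧
      -- the nonresonant case
      (∀ ω ρ : ℝ × ℝ, (ω, ρ) ∈ AngularValue.parameters → Irrational (ω.2 / ω.1) →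
        ϑ (ω, ρ) = AngularValue.nonresonantValue ω ρ) ∧
      -- the resonant case
      (∀ ω ρ : ℝ × ℝ, (ω, ρ) ∈ AngularValue.parameters →
        ∀ p q : ℕ, 0 < p → 0 < q → p.Coprime q → ω.2 / ω.1 = (p : ℝ) / q →
          IsLUB (AngularValue.resonantL ω ρ p q '' Icc 0 (2 * Real.pi)) (ϑ (ω, ρ))) ∧
      -- failure of lower semicontinuity, already for `ω = (1, κ)` and `ρ = (1/3, ρ₂)`
      ¬ LowerSemicontinuousOn (fun x : ℝ × ℝ => ϑ ((1, x.1), (1 / 3, x.2)))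
        (Ioc 0 1 ×ˢ Ioc 0 1) := by
  refine ⟨fun x => AngularValue.supMeanSpeed x.1 x.2, fun ω ρ h => ⟨fun V hV => ?_, ?_, ?_⟩,
    AngularValue.upperSemicontinuousOn_supMeanSpeed,
    fun ω ρ h hω => AngularValue.supMeanSpeed_of_irrational h hω,
    fun ω ρ h p q _ hq _ hpq => AngularValue.isLUB_resonantL h hq hpq,
    AngularValue.not_lowerSemicontinuousOn_supMeanSpeed⟩
  · obtain ⟨l, hl, -⟩ := AngularValue.exists_tendsto_averageSpeed h hV
    exact ⟨l, hl⟩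
  · exact AngularValue.iSup_eq_supMeanSpeed h fun V l hl =>
      ((continuous_coe_real_ereal.tendsto l).comp hl).limsup_eq
  · exact AngularValue.iSup_eq_supMeanSpeed h fun V l hl =>
      ((continuous_coe_real_ereal.tendsto l).comp hl).liminf_eq
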